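/- **Setting.** For $m\ge 0$ let $\mathcal P^m$ be the para-Kähler $m$-plane: $\mathbb R^{2m}$ with coordinates $(x_1,\dots,x_m,y_1,\dots,y_m)$, the flat neutral metric $g_0=-\sum_j dx_j^2+\sum_j dy_j^2$ and the almost product structure $\mathcal P(\partial_{x_j})=\partial_{y_j}$, $\mathcal P(\partial_{y_j})=\partial_{x_j}$. For a vector $X$ put $\|X\|_2=g_0(X,X)$. All manifolds, metrics, functions and maps are smooth. Let $h,p\ge 0$. Let $(N_\top,g_\top)$ be a connected pseudo-Riemannian manifold of dimension $2h$, $(N_\perp,g_\perp)$ a pseudo-Riemannian manifold of dimension $p$ and $f:N_\top\to(0,\infty)$ a non-constant function. A *$\mathcal PR$-warped product* $M=N_\top\times_f N_\perp$ in $\mathcal P^{h+p}$ is an isometric immersion $\Phi:(N_\top\times N_\perp,\ g=g_\top+f^2g_\perp)\to\mathcal P^{h+p}$ such that, for $\mathcal D=TN_\top$ and $\mathcal D^\perp=TN_\perp$ (identified with their images under $d\Phi$), $\mathcal P\mathcal D=\mathcal D$ and $\mathcal P\mathcal D^\perp\subseteq T^\perp M$. It is *space-like* if $g_\perp$ is positive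 definite. Note that the codimension is $p$, the least possible. Let $\sigma$ be the second fundamental form of $M$ and $S_\sigma=g_0(\sigma,\sigma)=\sum_{A,B}\epsilon_A\epsilon_B\,g_0(\sigma(e_A,e_B),\sigma(e_A,e_B))$ for any basis $(e_A)$ of $T_qM$ with $g(e_A,e_B)=\epsilon_A\delta_{AB}$, $\epsilon_A=\pm1$. Gradients are taken with respect to $g$. **Proposition.** Let $M=N_\top\times_fN_\perp$ be a space-like $\mathcal PR$-warped product in $\mathcal P^{h+p}$ such that $$S_\sigma=2p\,\|\nabla\ln f\|_2\quad\text{at every point of } M .$$ Then: 1. For every $y\in N_\perp$, $N_\top$ (immersed by $\Phi(\cdot,y)$) is totally geodesic in $\mathcal P^{h+p}$, i.e. its second fundamental form vanishes, and it is congruent to an open part of $\mathcal P^h$: after a rigid motion $v\mapsto Av+b$ of $\mathcal P^{h+p}$, with $A$ linear, preserving $g_0$ and commuting with $\mathcal P$, the immersion $\Phi(\cdot,y)$ becomes a local diffeomorphism from $N_\top$ onto an open subset of the standard $\mathcal P^h\subset\mathcal P^{h+p}$ (given by $x_j=y_j=0$ for $j>h$). 2. For every $x\in N_\top$, $N_\perp$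 (immersed by $\Phi(x,\cdot)$) is totally umbilical in $\mathcal P^{h+p}$: for every normal vector $\xi$ the shape operator $A_\xi$ is a multiple of the identity. 3. If moreover $p\ge 2$ and $(N_\perp,g_\perp)$ has constant curvature $k$, then $\|\nabla f\|_2=k$ at every point of $M$. -/

import Mathlib

open scoped Manifold ContDiff

noncomputable section

/-! ### The para-Kähler plane -/

/-- The underlying space `ℝ²ᵐ` of the para-Kähler `m`-plane, with coordinates
`(x₁, …, xₘ, y₁, …, yₘ)` written as a pair `(x, y)`. -/
abbrev ParaPlane (m : ℕ) : Type := (Fin m → ℝ) × (Fin m → ℝ)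

/-- The flat neutral metric `g₀ = - ∑ dxⱼ² + ∑ dyⱼ²`. -/
def paraMetric (m : ℕ) : LinearMap.BilinForm ℝ (ParaPlane m) :=
  LinearMap.mk₂ ℝ (fun v w => -(∑ j, v.1 j * w.1 j) + ∑ j, v.2 j * w.2 j)
    (by intro u v w; simp only [Prod.fst_add, Prod.snd_add, Pi.add_apply, add_mul,
          Finset.sum_add_distrib]; ring)
    (by intro c v w; simp only [Prod.smul_fst, Prod.smul_snd, Pi.smul_apply, smul_eq_mul,
          mul_assoc, ← Finset.mul_sum]; ring)
    (by intro u v w; simp only [Prod.fst_add, Prod.snd_add, Pi.add_apply, mul_add,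
          Finset.sum_add_distrib]; ring)
    (by intro c v w; simp only [Prod.smul_fst, Prod.smul_snd, Pi.smul_apply, smul_eq_mul,
          mul_left_comm _ c, ← Finset.mul_sum]; ring)

/-- The (constant) almost product structure `∑ ∂/∂yⱼ ⊗ dxⱼ + ∑ ∂/∂xⱼ ⊗ dyⱼ`,
i.e. `(x, y) ↦ (y, x)`. -/
def paraStructure (m : ℕ) : ParaPlane m →ₗ[ℝ] ParaPlane m :=
  LinearMap.prod (LinearMap.snd ℝ _ _) (LinearMap.fst ℝ _ _)

/-- The standard inclusion of the para-Kähler `h`-plane in the para-Kähler `(h + p)`-plane, as the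
locus `x_{h+1} = … = x_{h+p} = y_{h+1} = … = y_{h+p} = 0`. -/
def paraInclusion (h p : ℕ) (v : ParaPlane h) : ParaPlane (h + p) :=
  (Fin.append v.1 0, Fin.append v.2 0)

/-! ### Linear algebra of scalar products -/

section LinearAlgebra

variable {V : Type*} [AddCommGroup V] [Module ℝ V] [FiniteDimensional ℝ V]

open Classical in
/-- For a nondegenerate bilinear form `B`, `sharp B α` is the unique vector with
`B (sharp B α) v = α v` for all `v`. (It is set to `0` if `B` is degenerate.) -/
def sharp (B : LinearMap.BilinForm ℝ V) : Module.Dual ℝ V →ₗ[ℝ] V :=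
  if hB : B.Nondegenerate then (B.toDual hB).symm.toLinearMap else 0

theorem apply_sharp {B : LinearMap.BilinForm ℝ V} (hB : B.Nondegenerate)
    (α : Module.Dual ℝ V) (v : V) : B (sharp B α) v = α v := by
  simp [sharp, hB, LinearMap.BilinForm.apply_toDual_symm_apply]

open Classical in
/-- The full contraction `∑ Bⁱᵏ Bʲˡ ⟨σᵢⱼ, σₖₗ⟩` of a vector-valued bilinear map `σ` with respect to a
scalar product `B` on the source and `C` on the target, written with a basis and its `B`-dual basis.
See `contraction_eq_of_orthonormal` for its value in a pseudo-orthonormal basis. -/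
def contraction {W : Type*} [AddCommGroup W] [Module ℝ W]
    (B : LinearMap.BilinForm ℝ V) (C : LinearMap.BilinForm ℝ W) (σ : V →ₗ[ℝ] V →ₗ[ℝ] W) : ℝ :=
  if hB : B.Nondegenerate then
    ∑ i, ∑ j, C (σ (Module.finBasis ℝ V i) (Module.finBasis ℝ V j))
      (σ (B.dualBasis hB (Module.finBasis ℝ V) i) (B.dualBasis hB (Module.finBasis ℝ V) j))
  else 0

/-- `∑ᵢ T(bᵢ, bᵢ*)` does not depend on the basis. -/
theorem sum_dualBasis_eq {ι κ : Type*} [Fintype ι] [DecidableEq ι] [Fintype κ] [DecidableEq κ]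
    {B : LinearMap.BilinForm ℝ V} (hB : B.Nondegenerate) (b : Module.Basis ι ℝ V)
    (e : Module.Basis κ ℝ V) (T : LinearMap.BilinForm ℝ V) :
    ∑ i, T (b i) (B.dualBasis hB b i) = ∑ j, T (e j) (B.dualBasis hB e j) := by
  have h1 : ∀ i, B.dualBasis hB b i =
      ∑ j, B (B.dualBasis hB b i) (e j) • B.dualBasis hB e j := by
    intro i
    conv_lhs => rw [← (B.dualBasis hB e).sum_repr (B.dualBasis hB b i)]
    simp
  have h2 : ∀ j, e j = ∑ i, B (B.dualBasis hB b i) (e j) • b i := by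
    intro j
    conv_lhs => rw [← b.sum_repr (e j)]
    refine Finset.sum_congr rfl fun i _ => ?_
    have h3 : B (B.dualBasis hB b i) (∑ k, b.repr (e j) k • b k) = b.repr (e j) i := by
      simp only [map_sum, map_smul, LinearMap.BilinForm.apply_dualBasis_left, smul_eq_mul]
      simp
    rw [b.sum_repr] at h3
    rw [h3]
  calc ∑ i, T (b i) (B.dualBasis hB b i)
      = ∑ i, ∑ j, B (B.dualBasis hB b i) (e j) * T (b i) (B.dualBasis hB e j) := by
        refine Finset.sum_congr rfl fun i _ => ?_
        conv_lhs => rw [h1 i]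
        simp
    _ = ∑ j, ∑ i, B (B.dualBasis hB b i) (e j) * T (b i) (B.dualBasis hB e j) :=
        Finset.sum_comm
    _ = ∑ j, T (e j) (B.dualBasis hB e j) := by
        refine Finset.sum_congr rfl fun j _ => ?_
        conv_rhs => rw [h2 j]
        simp

/-- In a basis `e` with `B(eᵢ, eⱼ) = 0` for `i ≠ j` and `B(eᵢ, eᵢ) = εᵢ = ± 1`, the contraction is
`∑ εᵢ εⱼ ⟨σ(eᵢ, eⱼ), σ(eᵢ, eⱼ)⟩`. -/
theorem contraction_eq_of_orthonormal {W : Type*} [AddCommGroup W] [Module ℝ W]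
    {B : LinearMap.BilinForm ℝ V} (hB : B.Nondegenerate)
    (C : LinearMap.BilinForm ℝ W) (σ : V →ₗ[ℝ] V →ₗ[ℝ] W)
    {ι : Type*} [Fintype ι] [DecidableEq ι] (e : Module.Basis ι ℝ V) (ε : ι → ℝ)
    (hε : ∀ i, ε i = 1 ∨ ε i = -1) (he : ∀ i j, B (e i) (e j) = if i = j then ε i else 0) :
    contraction B C σ = ∑ i, ∑ j, ε i * ε j * C (σ (e i) (e j)) (σ (e i) (e j)) := by
  have hd : ∀ i, B.dualBasis hB e i = ε i • e i := by
    intro i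
    apply (B.dualBasis hB e).ext_elem
    intro j
    rw [LinearMap.BilinForm.dualBasis_repr_apply, LinearMap.BilinForm.dualBasis_repr_apply,
      LinearMap.BilinForm.apply_dualBasis_left]
    simp only [map_smul, LinearMap.smul_apply, he, smul_eq_mul]
    rcases hε i with h | h <;> by_cases hij : i = j
      <;> first | (subst hij; simp [h]) | simp [hij, Ne.symm hij]
  rw [contraction, dif_pos hB]
  set b := Module.finBasis ℝ V
  have s1 : ∀ i, ∑ j, C (σ (b i) (b j)) (σ (B.dualBasis hB b i) (B.dualBasis hB b j)) =
      ∑ j, C (σ (b i) (e j)) (σ (B.dualBasis hB b i) (B.dualBasis hB e j)) := fun i =>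
    sum_dualBasis_eq hB b e (C.compl₁₂ (σ (b i)) (σ (B.dualBasis hB b i)))
  have s2 : ∀ j, ∑ i, C (σ (b i) (e j)) (σ (B.dualBasis hB b i) (B.dualBasis hB e j)) =
      ∑ i, C (σ (e i) (e j)) (σ (B.dualBasis hB e i) (B.dualBasis hB e j)) := fun j =>
    sum_dualBasis_eq hB b e (C.compl₁₂ (σ.flip (e j)) (σ.flip (B.dualBasis hB e j)))
  simp_rw [s1]
  rw [Finset.sum_comm]
  simp_rw [s2]
  rw [Finset.sum_comm]
  refine Finset.sum_congr rfl fun i _ => Finset.sum_congr rfl fun j _ => ?_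
  simp only [hd, map_smul, LinearMap.smul_apply, smul_eq_mul]
  ring

end LinearAlgebra

/-! ### Pseudo-Riemannian metrics, constant curvature -/

section Metric

variable {E : Type*} [NormedAddCommGroup E] [NormedSpace ℝ E]
  {H : Type*} [TopologicalSpace H] (I : ModelWithCorners ℝ E H)
  (M : Type*) [TopologicalSpace M] [ChartedSpace H M] [IsManifold I ∞ M]

/-- A smooth pseudo-Riemannian metric (no condition on the signature). -/
structure PseudoRiemannianMetric where
  form (x : M) : TangentSpace I x →L[ℝ] TangentSpace I x →L[ℝ] ℝ
  symm (x : M) (u v : TangentSpace I x) : form x u v = form x v u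
  nondegenerate (x : M) (u : TangentSpace I x) (hu : ∀ v, form x u v = 0) : u = 0
  contMDiff : ContMDiff I (I.prod 𝓘(ℝ, E →L[ℝ] E →L[ℝ] ℝ)) ∞
    (fun x => Bundle.TotalSpace.mk' (E →L[ℝ] E →L[ℝ] ℝ) x (form x))

variable {I M}

/-- The metric is positive definite. -/
def PseudoRiemannianMetric.IsSpacelike (g : PseudoRiemannianMetric I M) : Prop :=
  ∀ (x : M) (u : TangentSpace I x), u ≠ 0 → 0 < g.form x u u

end Metric

section Curvature

variable {n : ℕ} {H : Type*} [TopologicalSpace H]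
  {I : ModelWithCorners ℝ (EuclideanSpace ℝ (Fin n)) H} [I.Boundaryless]
  {M : Type*} [TopologicalSpace M] [ChartedSpace H M] [IsManifold I ∞ M]

/-- The partial derivative `∂ᵢ F` at `z`. -/
def partialDeriv (i : Fin n) (F : EuclideanSpace ℝ (Fin n) → ℝ) (z : EuclideanSpace ℝ (Fin n)) :
    ℝ :=
  fderiv ℝ F z (EuclideanSpace.single i 1)

/-- The components `gᵢⱼ` of the metric in the coordinates given by the chart around `q`, at the
point with coordinates `z`. -/
def metricCoeff (g : PseudoRiemannianMetric I M) (q : M) (z : EuclideanSpace ℝ (Fin n)) :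
    Matrix (Fin n) (Fin n) ℝ :=
  Matrix.of fun i j =>
    g.form ((extChartAt I q).symm z)
      (mfderiv 𝓘(ℝ, EuclideanSpace ℝ (Fin n)) I (extChartAt I q).symm z
        (EuclideanSpace.single i (1 : ℝ)))
      (mfderiv 𝓘(ℝ, EuclideanSpace ℝ (Fin n)) I (extChartAt I q).symm z
        (EuclideanSpace.single j (1 : ℝ)))

/-- The Christoffel symbol `Γᵏᵢⱼ = ½ ∑ₗ gᵏˡ (∂ᵢ gⱼₗ + ∂ⱼ gᵢₗ - ∂ₗ gᵢⱼ)` of the Levi-Civita connection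
in the chart around `q`. -/
def christoffel (g : PseudoRiemannianMetric I M) (q : M) (k i j : Fin n)
    (z : EuclideanSpace ℝ (Fin n)) : ℝ :=
  (1 / 2) * ∑ l, (metricCoeff g q z)⁻¹ k l *
    (partialDeriv i (fun w => metricCoeff g q w j l) z
      + partialDeriv j (fun w => metricCoeff g q w i l) z
      - partialDeriv l (fun w => metricCoeff g q w i j) z)

/-- The component `Rˡₐᵢⱼ` of the curvature tensor in the chart around `q`, where
`R(∂ᵢ, ∂ⱼ) ∂ₐ = ∑ₗ Rˡₐᵢⱼ ∂ₗ` and `R(X, Y) = [∇_X, ∇_Y] - ∇_[X, Y]`. -/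
def curvatureCoeff (g : PseudoRiemannianMetric I M) (q : M) (l a i j : Fin n)
    (z : EuclideanSpace ℝ (Fin n)) : ℝ :=
  partialDeriv i (christoffel g q l j a) z - partialDeriv j (christoffel g q l i a) z
    + ∑ s, (christoffel g q l i s z * christoffel g q s j a z
      - christoffel g q l j s z * christoffel g q s i a z)

/-- Constant curvature `k`: `R(X, Y) Z = k (g(Y, Z) X - g(X, Z) Y)` at every point. -/
def HasConstantCurvature (g : PseudoRiemannianMetric I M) (k : ℝ) : Prop :=
  ∀ (q : M) (l a i j : Fin n),
    curvatureCoeff g q l a i j (extChartAt I q q) =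
      k * (metricCoeff g q (extChartAt I q q) j a * (if l = i then 1 else 0)
        - metricCoeff g q (extChartAt I q q) i a * (if l = j then 1 else 0))

end Curvature

/-! ### Submanifolds of the para-Kähler plane

Throughout, `M` is a manifold without boundary modelled on `E` and `φ : M → ParaPlane m` is the
immersion. By definition `TangentSpace I q` is `E`, a tangent vector being represented by its
coordinates in the chart around `q`. -/

section Submanifold

variable {E : Type*} [NormedAddCommGroup E] [NormedSpace ℝ E] [FiniteDimensional ℝ E]
  {H : Type*} [TopologicalSpace H] (I : ModelWithCorners ℝ E H) [I.Boundaryless]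
  {M : Type*} [TopologicalSpace M] [ChartedSpace H M]
  {m : ℕ} (φ : M → ParaPlane m) (q : M)

/-- The differential of `φ` at `q`. -/
def immersionDeriv : E →ₗ[ℝ] ParaPlane m :=
  ContinuousLinearMap.toLinearMap (M := E) (M₂ := ParaPlane m) (mfderiv I 𝓘(ℝ, ParaPlane m) φ q)

/-- The induced metric (first fundamental form) at `q`. -/
def inducedForm : LinearMap.BilinForm ℝ E :=
  (paraMetric m).compl₁₂ (immersionDeriv I φ q) (immersionDeriv I φ q)

/-- `φ` is a smooth immersion with nondegenerate induced metric. -/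
def IsPseudoRiemannianImmersion : Prop :=
  ContMDiff I 𝓘(ℝ, ParaPlane m) ∞ φ ∧ ∀ q, (inducedForm I φ q).Nondegenerate

/-- The vector `ξ` of the ambient space is normal to the submanifold at `q`. -/
def IsNormalVector (ξ : ParaPlane m) : Prop :=
  ∀ u : E, paraMetric m ξ (immersionDeriv I φ q u) = 0

/-- The tangential part of an ambient vector `w` at `q`, as a vector of `T_q M`: the unique `u` with
`g(u, v) = g₀(w, dφ v)` for all `v`. -/
def tangentialPart : ParaPlane m →ₗ[ℝ] E :=
  sharp (inducedForm I φ q) ∘ₗ (paraMetric m).compl₂ (immersionDeriv I φ q)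

/-- The normal part of an ambient vector at `q`. -/
def normalPart : ParaPlane m →ₗ[ℝ] ParaPlane m :=
  LinearMap.id - immersionDeriv I φ q ∘ₗ tangentialPart I φ q

/-- The second derivative of `φ` at `q` in the chart around `q`. -/
def secondDerivative : E →ₗ[ℝ] E →ₗ[ℝ] ParaPlane m :=
  (fderiv ℝ (fderiv ℝ (φ ∘ (extChartAt I q).symm)) (extChartAt I q q)).toLinearMap₁₂

/-- The second fundamental form `σ` at `q`. The ambient connection being flat, `σ(∂ᵢ, ∂ⱼ)` is the
normal part of `∂ᵢ ∂ⱼ φ`. -/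
def secondFundamentalForm : E →ₗ[ℝ] E →ₗ[ℝ] ParaPlane m :=
  (secondDerivative I φ q).compr₂ (normalPart I φ q)

/-- The shape operator `A_ξ` at `q`: `g(A_ξ u, v) = g₀(σ(u, v), ξ)`. -/
def shapeOperator (ξ : ParaPlane m) : E →ₗ[ℝ] E :=
  sharp (inducedForm I φ q) ∘ₗ
    (secondFundamentalForm I φ q).compr₂ ((paraMetric m).flip ξ)

/-- `S_σ = g₀(σ, σ)` at `q`. -/
def normSqSecondFundamentalForm : ℝ :=
  contraction (inducedForm I φ q) (paraMetric m) (secondFundamentalForm I φ q)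

/-- The differential of a function `F` on `M` at `q`. -/
def functionDeriv (F : M → ℝ) : Module.Dual ℝ E :=
  ContinuousLinearMap.toLinearMap (M := E) (M₂ := ℝ) (mfderiv I 𝓘(ℝ, ℝ) F q)

/-- `‖∇ F‖₂ = g(∇ F, ∇ F)` at `q`, the gradient of the function `F` being taken with respect to the
induced metric `g`. -/
def normSqGradient (F : M → ℝ) : ℝ :=
  inducedForm I φ q
    (sharp (inducedForm I φ q) (functionDeriv I q F))
    (sharp (inducedForm I φ q) (functionDeriv I q F))

/-- The second fundamental form vanishes identically. -/
def IsTotallyGeodesic : Prop :=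
  IsPseudoRiemannianImmersion I φ ∧ ∀ q, secondFundamentalForm I φ q = 0

/-- At each point, `A_ξ` is a multiple of the identity for every normal vector `ξ`. -/
def IsTotallyUmbilical : Prop :=
  IsPseudoRiemannianImmersion I φ ∧
    ∀ q ξ, IsNormalVector I φ q ξ → ∃ c : ℝ, shapeOperator I φ q ξ = c • LinearMap.id

/-- Up to a rigid motion `v ↦ A v + b` of the para-Kähler `(h + p)`-plane (`A` preserving the metric
and the para-Kähler structure), `φ` is a local diffeomorphism onto an open part of the standard
para-Kähler `h`-plane. -/
def IsCongruentToOpenPart (h p : ℕ) (φ : M → ParaPlane (h + p)) : Prop :=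
  ∃ (A : ParaPlane (h + p) ≃ₗ[ℝ] ParaPlane (h + p)) (b : ParaPlane (h + p)),
    (∀ v w, paraMetric (h + p) (A v) (A w) = paraMetric (h + p) v w) ∧
    (∀ v, A (paraStructure (h + p) v) = paraStructure (h + p) (A v)) ∧
    ∃ ψ : M → ParaPlane h, IsLocalDiffeomorph I 𝓘(ℝ, ParaPlane h) ∞ ψ ∧
      ∀ x, A (φ x) + b = paraInclusion h p (ψ x)

end Submanifold

/-! ### Warped products -/

section WarpedProduct

variable {E₁ : Type*} [NormedAddCommGroup E₁] [NormedSpace ℝ E₁] [FiniteDimensional ℝ E₁]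
  {H₁ : Type*} [TopologicalSpace H₁] {I₁ : ModelWithCorners ℝ E₁ H₁} [I₁.Boundaryless]
  {N₁ : Type*} [TopologicalSpace N₁] [ChartedSpace H₁ N₁] [IsManifold I₁ ∞ N₁]
  {E₂ : Type*} [NormedAddCommGroup E₂] [NormedSpace ℝ E₂] [FiniteDimensional ℝ E₂]
  {H₂ : Type*} [TopologicalSpace H₂] {I₂ : ModelWithCorners ℝ E₂ H₂} [I₂.Boundaryless]
  {N₂ : Type*} [TopologicalSpace N₂] [ChartedSpace H₂ N₂] [IsManifold I₂ ∞ N₂]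
  {m : ℕ}

/-- `Φ : N₁ × N₂ → ParaPlane m` makes the warped product `N₁ ×_f N₂`, with metric `g₁ + f² g₂`, a
`𝒫R`-warped product in the para-Kähler `m`-plane: `Φ` is an isometric immersion, the distribution
tangent to `N₁` is invariant, the distribution tangent to `N₂` is anti-invariant, and the positive
function `f` on `N₁` is not constant. -/
structure IsPRWarpedProduct (g₁ : PseudoRiemannianMetric I₁ N₁) (g₂ : PseudoRiemannianMetric I₂ N₂)
    (f : N₁ → ℝ) (Φ : N₁ × N₂ → ParaPlane m) : Prop where
  contMDiff_immersion : ContMDiff (I₁.prod I₂) 𝓘(ℝ, ParaPlane m) ∞ Φ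
  contMDiff_warping : ContMDiff I₁ 𝓘(ℝ, ℝ) ∞ f
  warping_pos : ∀ x, 0 < f x
  warping_nonconstant : ¬ ∃ c, ∀ x, f x = c
  isometric : ∀ (q : N₁ × N₂) (u v : E₁ × E₂), inducedForm (I₁.prod I₂) Φ q u v =
    g₁.form q.1 u.1 v.1 + f q.1 ^ 2 * g₂.form q.2 u.2 v.2
  invariant : ∀ (q : N₁ × N₂) (u : E₁), ∃ u' : E₁,
    paraStructure m (immersionDeriv (I₁.prod I₂) Φ q (u, 0)) = immersionDeriv (I₁.prod I₂) Φ q (u', 0)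
  antiinvariant : ∀ (q : N₁ × N₂) (w : E₂),
    IsNormalVector (I₁.prod I₂) Φ q (paraStructure m (immersionDeriv (I₁.prod I₂) Φ q (0, w)))

end WarpedProduct

end

/-! ### Linear algebra of the para-Kähler plane -/

section ParaPlane

variable {m : ℕ}

theorem paraMetric_apply (v w : ParaPlane m) :
    paraMetric m v w = -(∑ j, v.1 j * w.1 j) + ∑ j, v.2 j * w.2 j := rfl

theorem paraStructure_apply (v : ParaPlane m) : paraStructure m v = (v.2, v.1) := rfl

theorem paraStructure_paraStructure (v : ParaPlane m) :
    paraStructure m (paraStructure m v) = v := rfl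

theorem paraMetric_comm (v w : ParaPlane m) : paraMetric m v w = paraMetric m w v := by
  simp only [paraMetric_apply, mul_comm]

theorem paraMetric_paraStructure_left (v w : ParaPlane m) :
    paraMetric m (paraStructure m v) w = -paraMetric m v (paraStructure m w) := by
  simp only [paraMetric_apply, paraStructure_apply]; ring

theorem paraMetric_paraStructure_both (v w : ParaPlane m) :
    paraMetric m (paraStructure m v) (paraStructure m w) = -paraMetric m v w := by
  rw [paraMetric_paraStructure_left, paraStructure_paraStructure]

theorem eq_zero_of_paraMetric_left {v : ParaPlane m} (hv : ∀ w, paraMetric m v w = 0) : v = 0 := by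
  have h1 := hv (0, v.2)
  have h2 := hv (v.1, 0)
  simp only [paraMetric_apply, Pi.zero_apply, mul_zero, Finset.sum_const_zero, neg_zero, zero_add,
    add_zero, neg_eq_zero] at h1 h2
  rw [Finset.sum_eq_zero_iff_of_nonneg fun i _ => mul_self_nonneg _] at h1 h2
  ext i
  · simpa using h2 i (Finset.mem_univ i)
  · simpa using h1 i (Finset.mem_univ i)

theorem finrank_paraPlane : Module.finrank ℝ (ParaPlane m) = 2 * m := by
  simp [ParaPlane, Module.finrank_prod, two_mul]

end ParaPlane

/-! ### Scalar products -/

section ScalarProduct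

variable {V : Type*} [AddCommGroup V] [Module ℝ V]

theorem nondegenerate_of_symm {B : LinearMap.BilinForm ℝ V} (hs : ∀ u v, B u v = B v u)
    (h : ∀ u, (∀ v, B u v = 0) → u = 0) : B.Nondegenerate :=
  ⟨fun u hu => h u hu, fun u hu => h u fun v => by rw [hs]; exact hu v⟩

variable [FiniteDimensional ℝ V]

/-- A nondegenerate symmetric form has a pseudo-orthonormal basis. -/
theorem exists_pseudoOrthonormal_basis {B : LinearMap.BilinForm ℝ V} (hs : ∀ u v, B u v = B v u)
    (h : ∀ u, (∀ v, B u v = 0) → u = 0) :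
    ∃ (e : Module.Basis (Fin (Module.finrank ℝ V)) ℝ V) (ε : Fin (Module.finrank ℝ V) → ℝ),
      (∀ i, ε i = 1 ∨ ε i = -1) ∧ ∀ i j, B (e i) (e j) = if i = j then ε i else 0 := by
  obtain ⟨v, hv⟩ := LinearMap.BilinForm.exists_orthogonal_basis (B := B) ⟨fun u w => by simp [hs u w]⟩
  have hv' : ∀ i j, i ≠ j → B (v i) (v j) = 0 := fun i j hij => hv hij
  have hne : ∀ i, B (v i) (v i) ≠ 0 := by
    intro i h0
    refine v.ne_zero i (h _ fun w => ?_)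
    rw [← v.sum_repr w]
    simp only [map_sum, map_smul, smul_eq_mul]
    refine Finset.sum_eq_zero fun j _ => ?_
    by_cases hij : i = j
    · subst hij; simp [h0]
    · simp [hv' i j hij]
  have hpos : ∀ i, 0 < Real.sqrt |B (v i) (v i)| := fun i => Real.sqrt_pos.2 (abs_pos.2 (hne i))
  refine ⟨v.isUnitSMul (w := fun i => (Real.sqrt |B (v i) (v i)|)⁻¹)
    fun i => (inv_ne_zero (hpos i).ne').isUnit, fun i => B (v i) (v i) / |B (v i) (v i)|, ?_, ?_⟩
  · intro i
    rcases lt_or_gt_of_ne (hne i) with h1 | h1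
    · right; simp only; rw [abs_of_neg h1, div_neg, div_self (hne i)]
    · left; simp only; rw [abs_of_pos h1, div_self (hne i)]
  · intro i j
    simp only [Module.Basis.isUnitSMul_apply, map_smul, LinearMap.smul_apply, smul_eq_mul]
    by_cases hij : i = j
    · subst hij
      simp only [if_true]
      rw [← mul_assoc, ← mul_inv, Real.mul_self_sqrt (abs_nonneg _), inv_mul_eq_div]
    · simp [hij, hv' i j hij]

omit [FiniteDimensional ℝ V] in
/-- Parseval's identity in a pseudo-orthonormal basis. -/
theorem sum_pseudoOrthonormal_sq {B : LinearMap.BilinForm ℝ V}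
    {ι : Type*} [Fintype ι] [DecidableEq ι] (e : Module.Basis ι ℝ V) (ε : ι → ℝ)
    (hε : ∀ i, ε i = 1 ∨ ε i = -1) (he : ∀ i j, B (e i) (e j) = if i = j then ε i else 0) (u : V) :
    ∑ i, ε i * B u (e i) ^ 2 = B u u := by
  have h1 : ∀ i, B u (e i) = e.repr u i * ε i := by
    intro i
    conv_lhs => rw [← e.sum_repr u]
    simp only [map_sum, map_smul, LinearMap.sum_apply, LinearMap.smul_apply, smul_eq_mul, he]
    simp
  conv_rhs => arg 2; rw [← e.sum_repr u]
  simp only [map_sum, map_smul, smul_eq_mul]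
  refine Finset.sum_congr rfl fun i _ => ?_
  rw [h1]
  rcases hε i with h | h <;> rw [h] <;> ring

end ScalarProduct

/-! ### Pointwise structure of a warped product -/

section Jet

variable {E₁ E₂ : Type*} [AddCommGroup E₁] [Module ℝ E₁] [AddCommGroup E₂] [Module ℝ E₂] {m : ℕ}

/-- The algebraic relations satisfied at a point by the first derivative `A` and the second
derivative `B` of the immersion of a `𝒫R`-warped product; `g₁` and `g₂` are the restrictions of the
metric to the two distributions, and `θ` is the differential of `ln f`. -/
structure IsPRJet (A : E₁ × E₂ →ₗ[ℝ] ParaPlane m)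
    (B : E₁ × E₂ →ₗ[ℝ] E₁ × E₂ →ₗ[ℝ] ParaPlane m)
    (g₁ : LinearMap.BilinForm ℝ E₁) (g₂ : LinearMap.BilinForm ℝ E₂) (θ : Module.Dual ℝ E₁) :
    Prop where
  symm : ∀ u v, B u v = B v u
  metric : ∀ u v, paraMetric m (A u) (A v) = g₁ u.1 v.1 + g₂ u.2 v.2
  nondegenerate : ∀ X, (∀ Y, g₁ X Y = 0) → X = 0
  pos : ∀ Z, Z ≠ 0 → 0 < g₂ Z Z
  invariant : ∀ X, ∃ X', paraStructure m (A (X, 0)) = A (X', 0)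
  antiinvariant : ∀ W v, paraMetric m (paraStructure m (A (0, W))) (A v) = 0
  deriv_mixed : ∀ T X Z, paraMetric m (B T (X, 0)) (A (0, Z)) + paraMetric m (A (X, 0)) (B T (0, Z)) = 0
  deriv_fst : ∀ Z X Y, paraMetric m (B (0, Z) (X, 0)) (A (Y, 0))
    + paraMetric m (A (X, 0)) (B (0, Z) (Y, 0)) = 0
  deriv_snd : ∀ X Z W, paraMetric m (B (X, 0) (0, Z)) (A (0, W))
    + paraMetric m (A (0, Z)) (B (X, 0) (0, W)) = 2 * θ X * g₂ Z W
  deriv_antiinvariant : ∀ T W u, paraMetric m (paraStructure m (B T (0, W))) (A u)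
    + paraMetric m (paraStructure m (A (0, W))) (B T u) = 0

namespace IsPRJet

variable {A : E₁ × E₂ →ₗ[ℝ] ParaPlane m} {B : E₁ × E₂ →ₗ[ℝ] E₁ × E₂ →ₗ[ℝ] ParaPlane m}
  {g₁ : LinearMap.BilinForm ℝ E₁} {g₂ : LinearMap.BilinForm ℝ E₂} {θ : Module.Dual ℝ E₁}

section
variable (J : IsPRJet A B g₁ g₂ θ)
include J

theorem metric_fst (X : E₁) (v : E₁ × E₂) : paraMetric m (A (X, 0)) (A v) = g₁ X v.1 := by
  simp [J.metric]

theorem metric_snd (Z : E₂) (v : E₁ × E₂) : paraMetric m (A (0, Z)) (A v) = g₂ Z v.2 := by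
  simp [J.metric]

theorem symm_fst (X Y : E₁) : g₁ X Y = g₁ Y X := by
  have := J.metric_fst X (Y, 0)
  rw [paraMetric_comm, J.metric_fst Y (X, 0)] at this
  exact this.symm

theorem symm_snd (X Y : E₂) : g₂ X Y = g₂ Y X := by
  have := J.metric_snd X (0, Y)
  rw [paraMetric_comm, J.metric_snd Y (0, X)] at this
  exact this.symm

theorem anti_metric (Z W : E₂) :
    paraMetric m (paraStructure m (A (0, Z))) (paraStructure m (A (0, W))) = -g₂ Z W := by
  rw [paraMetric_paraStructure_both, J.metric_snd]

theorem metric_nondegenerate : ((paraMetric m).compl₁₂ A A).Nondegenerate := by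
  refine nondegenerate_of_symm (fun u v => paraMetric_comm _ _) fun u hu => ?_
  have h0 : ∀ v : E₁ × E₂, g₁ u.1 v.1 + g₂ u.2 v.2 = 0 := fun v => by rw [← J.metric]; exact hu v
  ext1
  · exact J.nondegenerate _ fun Y => by simpa using h0 (Y, 0)
  · by_contra hne
    have := h0 (0, u.2)
    simp only [map_zero, zero_add] at this
    exact (J.pos _ hne).ne' this

theorem second_mixed_fst (X Y : E₁) (Z : E₂) :
    paraMetric m (B (X, 0) (0, Z)) (A (Y, 0)) = 0 := by
  have h1 := J.deriv_fst Z X Y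
  have h2 := J.deriv_mixed (X, 0) Y Z
  have h3 := J.deriv_mixed (Y, 0) X Z
  rw [J.symm (0, Z), J.symm (0, Z)] at h1
  rw [paraMetric_comm (A (Y, 0))] at h2
  rw [J.symm (Y, 0) (X, 0)] at h3
  linarith

theorem second_fst_snd (X Y : E₁) (Z : E₂) :
    paraMetric m (B (X, 0) (Y, 0)) (A (0, Z)) = 0 := by
  have h2 := J.deriv_mixed (X, 0) Y Z
  rw [paraMetric_comm (A (Y, 0)), J.second_mixed_fst] at h2
  linarith

theorem second_snd_fst (Z W : E₂) (X : E₁) :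
    paraMetric m (B (0, Z) (0, W)) (A (X, 0)) = -θ X * g₂ Z W := by
  have h1 := J.deriv_snd X Z W
  have h2 := J.deriv_mixed (0, Z) X W
  have h3 := J.deriv_mixed (0, W) X Z
  rw [J.symm (0, Z) (X, 0)] at h2
  rw [J.symm (0, W) (X, 0), J.symm (0, W) (0, Z)] at h3
  rw [paraMetric_comm (A (0, Z))] at h1
  rw [paraMetric_comm (A (X, 0))] at h2 h3
  linarith

theorem second_mixed_snd (X : E₁) (Z W : E₂) :
    paraMetric m (B (X, 0) (0, Z)) (A (0, W)) = θ X * g₂ Z W := by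
  have h2 := J.deriv_mixed (0, Z) X W
  rw [J.symm (0, Z) (X, 0), paraMetric_comm (A (X, 0)), J.second_snd_fst] at h2
  linarith

theorem second_fst_anti (X Y : E₁) (Z : E₂) :
    paraMetric m (B (X, 0) (Y, 0)) (paraStructure m (A (0, Z))) = 0 := by
  have h := J.deriv_antiinvariant (X, 0) Z (Y, 0)
  obtain ⟨Y', hY⟩ := J.invariant Y
  rw [paraMetric_paraStructure_left, hY, J.second_mixed_fst] at h
  rw [paraMetric_comm]
  linarith

theorem second_mixed_anti {X X' : E₁} (hX : paraStructure m (A (X, 0)) = A (X', 0)) (Z W : E₂) :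
    paraMetric m (B (X, 0) (0, Z)) (paraStructure m (A (0, W))) = -θ X' * g₂ Z W := by
  have h := J.deriv_antiinvariant (0, Z) W (X, 0)
  rw [paraMetric_paraStructure_left, hX, J.second_snd_fst, J.symm (0, Z) (X, 0)] at h
  rw [paraMetric_comm]
  linarith

variable [FiniteDimensional ℝ E₁] [FiniteDimensional ℝ E₂]

theorem exists_decomposition
    (hdim : Module.finrank ℝ E₁ + 2 * Module.finrank ℝ E₂ = 2 * m) (v : ParaPlane m) :
    ∃ u W, v = A u + paraStructure m (A (0, W)) := by
  let L : (E₁ × E₂) × E₂ →ₗ[ℝ] ParaPlane m :=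
    A.coprod (paraStructure m ∘ₗ A ∘ₗ LinearMap.inr ℝ E₁ E₂)
  have hinj : Function.Injective L := by
    rw [injective_iff_map_eq_zero]
    rintro ⟨⟨X, Z⟩, W⟩ h
    have h0 : A (X, Z) + paraStructure m (A (0, W)) = 0 := h
    have hW : W = 0 := by
      by_contra hne
      have h1 := congrArg (paraMetric m (paraStructure m (A (0, W)))) h0
      rw [map_add, J.antiinvariant, J.anti_metric, map_zero] at h1
      linarith [J.pos W hne]
    subst hW
    have h2 : A (X, Z) = 0 := by
      rwa [show ((0 : E₁), (0 : E₂)) = 0 from rfl, map_zero, map_zero, add_zero] at h0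
    have hZ : Z = 0 := by
      by_contra hne
      have h1 := J.metric_snd Z (X, Z)
      rw [h2, map_zero] at h1
      linarith [J.pos Z hne]
    have hX : X = 0 := by
      refine J.nondegenerate X fun Y => ?_
      have h1 := J.metric_fst Y (X, Z)
      rw [h2, map_zero] at h1
      rw [J.symm_fst, ← h1]
    simp [hX, hZ]
  have hsurj : Function.Surjective L := by
    rw [← LinearMap.injective_iff_surjective_of_finrank_eq_finrank]
    · exact hinj
    · rw [finrank_paraPlane, Module.finrank_prod, Module.finrank_prod]; omega
  obtain ⟨⟨u, W⟩, h⟩ := hsurj v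
  exact ⟨u, W, h.symm⟩

/-- The mixed part of the second derivative. -/
theorem second_mixed (hdim : Module.finrank ℝ E₁ + 2 * Module.finrank ℝ E₂ = 2 * m)
    {X X' : E₁} (hX : paraStructure m (A (X, 0)) = A (X', 0)) (Z : E₂) :
    B (X, 0) (0, Z) = θ X • A (0, Z) + θ X' • paraStructure m (A (0, Z)) := by
  rw [← sub_eq_zero]
  refine eq_zero_of_paraMetric_left fun w => ?_
  obtain ⟨⟨Y, W⟩, W', rfl⟩ := J.exists_decomposition hdim w
  have : A (Y, W) = A (Y, 0) + A (0, W) := by rw [← map_add]; simp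
  rw [this]
  simp only [map_add, map_sub, map_smul, LinearMap.sub_apply, LinearMap.add_apply,
    LinearMap.smul_apply, smul_eq_mul, J.second_mixed_fst, J.second_mixed_snd,
    J.second_mixed_anti hX, J.metric_snd, J.antiinvariant, J.anti_metric]
  rw [paraMetric_comm (A (0, Z)), J.antiinvariant]
  simp

/-- The null vectors `A Z ± P A Z` have derivative proportional to themselves. -/
theorem second_mixed_null (hdim : Module.finrank ℝ E₁ + 2 * Module.finrank ℝ E₂ = 2 * m)
    {s : ℝ} (hs : s * s = 1) (X : E₁) :
    ∃ c : ℝ, ∀ Z, B (X, 0) (0, Z) + s • paraStructure m (B (X, 0) (0, Z)) =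
      c • (A (0, Z) + s • paraStructure m (A (0, Z))) := by
  obtain ⟨X', hX⟩ := J.invariant X
  refine ⟨θ X + s * θ X', fun Z => ?_⟩
  rw [J.second_mixed hdim hX]
  simp only [map_add, map_smul, paraStructure_paraStructure, smul_add, smul_smul, add_smul]
  rw [add_mul, show s * θ X' * s = θ X' by rw [mul_right_comm, hs, one_mul], add_smul,
    mul_comm (θ X) s]
  abel

omit [FiniteDimensional ℝ E₂] in
theorem exists_gradient : ∃ n, ∀ X, g₁ n X = θ X := by
  have hB := nondegenerate_of_symm J.symm_fst J.nondegenerate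
  exact ⟨sharp g₁ θ, fun X => apply_sharp hB θ X⟩

/-- The second derivative in the directions of the second factor has no component in the directions
orthogonal to the invariant and anti-invariant distributions, when `S_σ = 2p ‖∇ ln f‖`. -/
theorem second_snd_anti (hdim : Module.finrank ℝ E₁ + 2 * Module.finrank ℝ E₂ = 2 * m)
    {n : E₁} (hn : ∀ X, g₁ n X = θ X) (ν : ParaPlane m →ₗ[ℝ] ParaPlane m)
    (hν : ∀ u, ν (A u) = 0) (hν' : ∀ W, ν (paraStructure m (A (0, W))) = paraStructure m (A (0, W)))
    (hS : contraction ((paraMetric m).compl₁₂ A A) (paraMetric m) (B.compr₂ ν) =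
      2 * Module.finrank ℝ E₂ * g₁ n n) (Z W T : E₂) :
    paraMetric m (B (0, Z) (0, W)) (paraStructure m (A (0, T))) = 0 := by
  obtain ⟨e₁, ε, hε, he₁⟩ := exists_pseudoOrthonormal_basis J.symm_fst J.nondegenerate
  obtain ⟨e₂, δ, hδ, he₂⟩ := exists_pseudoOrthonormal_basis J.symm_snd fun Z hZ => by
    by_contra hne
    exact (J.pos Z hne).ne' (hZ Z)
  have hδ1 : ∀ i, δ i = 1 := by
    intro i
    refine (hδ i).resolve_right fun h => ?_
    have := J.pos (e₂ i) (e₂.ne_zero i)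
    rw [he₂ i i, if_pos rfl, h] at this
    linarith
  have hsig : ∀ v, ∃ W, ν v = paraStructure m (A (0, W)) := by
    intro v
    obtain ⟨u, W, rfl⟩ := J.exists_decomposition hdim v
    exact ⟨W, by rw [map_add, hν, hν', zero_add]⟩
  have hpair : ∀ v W, paraMetric m (ν v) (paraStructure m (A (0, W))) =
      paraMetric m v (paraStructure m (A (0, W))) := by
    intro v W
    obtain ⟨u, W', rfl⟩ := J.exists_decomposition hdim v
    rw [map_add, hν, hν', zero_add, map_add, LinearMap.add_apply, paraMetric_comm (A u),
      J.antiinvariant, zero_add]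
  have hnonpos : ∀ v, paraMetric m (ν v) (ν v) ≤ 0 := by
    intro v
    obtain ⟨W, hW⟩ := hsig v
    rw [hW, J.anti_metric]
    by_cases h : W = 0
    · simp [h]
    · linarith [J.pos W h]
  have hzero : ∀ v, paraMetric m (ν v) (ν v) = 0 → ν v = 0 := by
    intro v hv
    obtain ⟨W, hW⟩ := hsig v
    rw [hW, J.anti_metric] at hv
    by_cases h : W = 0
    · rw [hW, h, show ((0 : E₁), (0 : E₂)) = 0 from rfl, map_zero, map_zero]
    · linarith [J.pos W h]
  have h11 : ∀ X Y, ν (B (X, 0) (Y, 0)) = 0 := by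
    intro X Y
    obtain ⟨W, hW⟩ := hsig (B (X, 0) (Y, 0))
    have := hpair (B (X, 0) (Y, 0)) W
    rw [J.second_fst_anti, ← hW] at this
    exact hzero _ this
  obtain ⟨n', hn'⟩ := J.invariant n
  have h12 : ∀ X Z, paraMetric m (ν (B (X, 0) (0, Z))) (ν (B (X, 0) (0, Z))) =
      -(g₁ n' X ^ 2 * g₂ Z Z) := by
    intro X Z
    obtain ⟨X', hX⟩ := J.invariant X
    have h1 : θ X' = -g₁ n' X := by
      rw [← hn, ← J.metric_fst n (X', 0), ← hX, ← J.metric_fst n' (X, 0), ← hn',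
        paraMetric_paraStructure_left, neg_neg]
    rw [J.second_mixed hdim hX, map_add, map_smul, map_smul, hν, hν', smul_zero, zero_add, map_smul,
      map_smul, LinearMap.smul_apply, J.anti_metric, h1]
    simp only [smul_eq_mul]; ring
  have hnn : g₁ n' n' = -g₁ n n := by
    rw [← J.metric_fst n' (n', 0), ← hn', paraMetric_paraStructure_both, J.metric_fst]
  have hcontr := contraction_eq_of_orthonormal J.metric_nondegenerate (paraMetric m) (B.compr₂ ν) (e₁.prod e₂)
    (Sum.elim ε δ) (by rintro (i | i); exacts [hε i, hδ i]) (by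
      rintro (i | i) (j | j) <;> simp [J.metric, he₁, he₂])
  rw [hS, Fintype.sum_sum_type] at hcontr
  simp only [Fintype.sum_sum_type, Sum.elim_inl, Sum.elim_inr, LinearMap.compr₂_apply,
    Module.Basis.prod_apply, Function.comp_apply,
    LinearMap.inl_apply, LinearMap.inr_apply, h11, map_zero, mul_zero, Finset.sum_const_zero,
    zero_add, J.symm (0, _) (_, 0), h12, hδ1, one_mul, mul_one, he₂, if_true,
    Finset.sum_add_distrib] at hcontr
  have hpars := sum_pseudoOrthonormal_sq e₁ ε hε he₁ n'
  have hsum : ∑ i, ∑ j, paraMetric m (ν (B (0, e₂ i) (0, e₂ j))) (ν (B (0, e₂ i) (0, e₂ j))) = 0 := by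
    simp only [mul_neg, Finset.sum_neg_distrib, Finset.sum_const, Finset.card_univ,
      Fintype.card_fin, nsmul_eq_mul, ← Finset.mul_sum, hpars, hnn] at hcontr
    linarith
  have hneg : ∑ i, ∑ j,
      -paraMetric m (ν (B (0, e₂ i) (0, e₂ j))) (ν (B (0, e₂ i) (0, e₂ j))) = 0 := by
    simp only [Finset.sum_neg_distrib, hsum, neg_zero]
  have h22 : ∀ i j, ν (B (0, e₂ i) (0, e₂ j)) = 0 := by
    intro i j
    rw [Finset.sum_eq_zero_iff_of_nonneg fun i _ =>
      Finset.sum_nonneg fun j _ => neg_nonneg.2 (hnonpos _)] at hneg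
    have hi := hneg i (Finset.mem_univ i)
    rw [Finset.sum_eq_zero_iff_of_nonneg fun j _ => neg_nonneg.2 (hnonpos _)] at hi
    exact hzero _ (neg_eq_zero.1 (hi j (Finset.mem_univ j)))
  have hlin : ((B.compr₂ ν).compl₁₂ (LinearMap.inr ℝ E₁ E₂) (LinearMap.inr ℝ E₁ E₂)) = 0 :=
    e₂.ext fun i => e₂.ext fun j => h22 i j
  have hZW : ν (B (0, Z) (0, W)) = 0 := LinearMap.congr_fun₂ hlin Z W
  rw [← hpair, hZW, map_zero, LinearMap.zero_apply]

end

end IsPRJet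

end Jet

section Jet

variable {E₁ E₂ : Type*} [AddCommGroup E₁] [Module ℝ E₁] [FiniteDimensional ℝ E₁]
  [AddCommGroup E₂] [Module ℝ E₂] [FiniteDimensional ℝ E₂] {m : ℕ}
  {A : E₁ × E₂ →ₗ[ℝ] ParaPlane m} {B : E₁ × E₂ →ₗ[ℝ] E₁ × E₂ →ₗ[ℝ] ParaPlane m}
  {g₁ : LinearMap.BilinForm ℝ E₁} {g₂ : LinearMap.BilinForm ℝ E₂} {θ : Module.Dual ℝ E₁}

namespace IsPRJet

theorem second_fst (J : IsPRJet A B g₁ g₂ θ)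
    (hdim : Module.finrank ℝ E₁ + 2 * Module.finrank ℝ E₂ = 2 * m) (X Y : E₁) :
    ∃ V, B (X, 0) (Y, 0) = A (V, 0) := by
  obtain ⟨⟨V, Z⟩, T, h⟩ := J.exists_decomposition hdim (B (X, 0) (Y, 0))
  have hT : T = 0 := by
    by_contra hne
    have h1 := J.second_fst_anti X Y T
    rw [h, map_add, LinearMap.add_apply, J.anti_metric, paraMetric_comm, J.antiinvariant] at h1
    linarith [J.pos T hne]
  rw [hT, show ((0 : E₁), (0 : E₂)) = 0 from rfl, map_zero, map_zero, add_zero] at h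
  have hZ : Z = 0 := by
    by_contra hne
    have h1 := J.second_fst_snd X Y Z
    rw [h, paraMetric_comm, J.metric_snd] at h1
    linarith [J.pos Z hne]
  exact ⟨V, by rw [h, hZ]⟩

theorem second_snd (J : IsPRJet A B g₁ g₂ θ)
    (hdim : Module.finrank ℝ E₁ + 2 * Module.finrank ℝ E₂ = 2 * m)
    {n : E₁} (hn : ∀ X, g₁ n X = θ X)
    (hC : ∀ Z W T, paraMetric m (B (0, Z) (0, W)) (paraStructure m (A (0, T))) = 0) (Z W : E₂) :
    ∃ V, B (0, Z) (0, W) = A (0, V) - g₂ Z W • A (n, 0) := by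
  obtain ⟨⟨X, V⟩, T, h⟩ := J.exists_decomposition hdim (B (0, Z) (0, W))
  have hT : T = 0 := by
    by_contra hne
    have h1 := hC Z W T
    rw [h, map_add, LinearMap.add_apply, J.anti_metric, paraMetric_comm, J.antiinvariant] at h1
    linarith [J.pos T hne]
  rw [hT, show ((0 : E₁), (0 : E₂)) = 0 from rfl, map_zero, map_zero, add_zero] at h
  have hX : X = -(g₂ Z W • n) := by
    rw [← sub_eq_zero]
    refine J.nondegenerate _ fun Y => ?_
    have h1 := J.second_snd_fst Z W Y
    rw [h, paraMetric_comm, J.metric_fst, J.symm_fst] at h1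
    simp only [map_sub, map_neg, map_smul, LinearMap.sub_apply, LinearMap.neg_apply,
      LinearMap.smul_apply, hn, smul_eq_mul, h1]
    ring
  refine ⟨V, ?_⟩
  rw [h, hX, ← map_smul, ← map_sub]
  simp

end IsPRJet

end Jet

/-! ### Tangential and normal parts -/

section Submanifold

variable {E : Type*} [NormedAddCommGroup E] [NormedSpace ℝ E] [FiniteDimensional ℝ E]
  {H : Type*} [TopologicalSpace H] {I : ModelWithCorners ℝ E H}
  {M : Type*} [TopologicalSpace M] [ChartedSpace H M]
  {m : ℕ} {φ : M → ParaPlane m} {q : M}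

theorem inducedForm_tangentialPart [I.Boundaryless] (hg : (inducedForm I φ q).Nondegenerate)
    (w : ParaPlane m) (v : E) :
    inducedForm I φ q (tangentialPart I φ q w) v = paraMetric m w (immersionDeriv I φ q v) :=
  apply_sharp hg _ v

theorem normalPart_immersionDeriv [I.Boundaryless] (hg : (inducedForm I φ q).Nondegenerate) (u : E) :
    normalPart I φ q (immersionDeriv I φ q u) = 0 := by
  have : tangentialPart I φ q (immersionDeriv I φ q u) = u := by
    rw [← sub_eq_zero]
    refine hg.1 _ fun v => ?_
    rw [map_sub, LinearMap.sub_apply, inducedForm_tangentialPart hg]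
    exact sub_self _
  simp [normalPart, this]

theorem normalPart_of_isNormalVector [I.Boundaryless] (hg : (inducedForm I φ q).Nondegenerate)
    {ξ : ParaPlane m} (hξ : IsNormalVector I φ q ξ) : normalPart I φ q ξ = ξ := by
  have : tangentialPart I φ q ξ = 0 := by
    refine hg.1 _ fun v => ?_
    rw [inducedForm_tangentialPart hg]
    exact hξ v
  simp [normalPart, this]

end Submanifold

/-! ### The immersion in coordinates -/

section Local

variable {E₁ E₂ : Type*} [NormedAddCommGroup E₁] [NormedSpace ℝ E₁]
  [NormedAddCommGroup E₂] [NormedSpace ℝ E₂] {m : ℕ}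

/-- The coordinate expression of a `𝒫R`-warped product on a product of open sets. -/
structure IsLocalPRWarpedProduct (F : E₁ × E₂ → ParaPlane m) (T₁ : Set E₁) (T₂ : Set E₂)
    (G₁ : E₁ → LinearMap.BilinForm ℝ E₁) (G₂ : E₂ → LinearMap.BilinForm ℝ E₂) (ρ : E₁ → ℝ) :
    Prop where
  isOpen_fst : IsOpen T₁
  isOpen_snd : IsOpen T₂
  contDiffOn : ContDiffOn ℝ ∞ F (T₁ ×ˢ T₂)
  contDiffOn_warping : ContDiffOn ℝ ∞ ρ T₁
  warping_pos : ∀ x ∈ T₁, 0 < ρ x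
  metric : ∀ x ∈ T₁, ∀ y ∈ T₂, ∀ u v, paraMetric m (fderiv ℝ F (x, y) u) (fderiv ℝ F (x, y) v) =
    G₁ x u.1 v.1 + ρ x ^ 2 * G₂ y u.2 v.2
  nondegenerate : ∀ x ∈ T₁, ∀ X, (∀ Y, G₁ x X Y = 0) → X = 0
  pos : ∀ y ∈ T₂, ∀ Z, Z ≠ 0 → 0 < G₂ y Z Z
  invariant : ∀ x ∈ T₁, ∀ y ∈ T₂, ∀ X, ∃ X',
    paraStructure m (fderiv ℝ F (x, y) (X, 0)) = fderiv ℝ F (x, y) (X', 0)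
  antiinvariant : ∀ x ∈ T₁, ∀ y ∈ T₂, ∀ W v,
    paraMetric m (paraStructure m (fderiv ℝ F (x, y) (0, W))) (fderiv ℝ F (x, y) v) = 0

theorem hasDerivAt_paraMetric {a b : ℝ → ParaPlane m} {a' b' : ParaPlane m} {t : ℝ}
    (ha : HasDerivAt a a' t) (hb : HasDerivAt b b' t) :
    HasDerivAt (fun s => paraMetric m (a s) (b s))
      (paraMetric m a' (b t) + paraMetric m (a t) b') t := by
  have := ((paraMetric m).toContinuousBilinearMap.hasFDerivAt_of_bilinear
    ha.hasFDerivAt hb.hasFDerivAt).hasDerivAt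
  simpa [add_comm] using this

namespace IsLocalPRWarpedProduct

variable {F : E₁ × E₂ → ParaPlane m} {T₁ : Set E₁} {T₂ : Set E₂}
  {G₁ : E₁ → LinearMap.BilinForm ℝ E₁} {G₂ : E₂ → LinearMap.BilinForm ℝ E₂} {ρ : E₁ → ℝ}
  (hF : IsLocalPRWarpedProduct F T₁ T₂ G₁ G₂ ρ)
include hF

theorem isOpen_prod : IsOpen (T₁ ×ˢ T₂) := hF.isOpen_fst.prod hF.isOpen_snd

theorem contDiffAt {x : E₁} {y : E₂} (hx : x ∈ T₁) (hy : y ∈ T₂) : ContDiffAt ℝ ∞ F (x, y) :=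
  hF.contDiffOn.contDiffAt (hF.isOpen_prod.mem_nhds ⟨hx, hy⟩)

theorem differentiableAt {x : E₁} {y : E₂} (hx : x ∈ T₁) (hy : y ∈ T₂) :
    DifferentiableAt ℝ F (x, y) :=
  (hF.contDiffAt hx hy).differentiableAt (by simp)

theorem hasFDerivAt_fderiv {x : E₁} {y : E₂} (hx : x ∈ T₁) (hy : y ∈ T₂) :
    HasFDerivAt (fderiv ℝ F) (fderiv ℝ (fderiv ℝ F) (x, y)) (x, y) :=
  (((hF.contDiffAt hx hy).fderiv_right (m := 1) (by norm_cast)).differentiableAt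
    (by simp)).hasFDerivAt

theorem hasDerivAt_fderiv {x : E₁} {y : E₂} (hx : x ∈ T₁) (hy : y ∈ T₂) (T u : E₁ × E₂) :
    HasDerivAt (fun t : ℝ => fderiv ℝ F ((x, y) + t • T) u)
      (fderiv ℝ (fderiv ℝ F) (x, y) T u) 0 := by
  have h1 : HasDerivAt (fun t : ℝ => (x, y) + t • T) T 0 := by
    simpa using ((hasDerivAt_id (0 : ℝ)).smul_const T).const_add (x, y)
  have h2 : HasDerivAt (fun t : ℝ => fderiv ℝ F ((x, y) + t • T))
      (fderiv ℝ (fderiv ℝ F) (x, y) T) 0 :=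
    HasFDerivAt.comp_hasDerivAt (0 : ℝ) (by simpa using hF.hasFDerivAt_fderiv hx hy) h1
  exact ((ContinuousLinearMap.apply ℝ (ParaPlane m) u).hasFDerivAt.comp_hasDerivAt (0 : ℝ) h2)

theorem eventually_mem {x : E₁} {y : E₂} (hx : x ∈ T₁) (hy : y ∈ T₂) (T : E₁ × E₂) :
    ∀ᶠ t : ℝ in nhds 0, x + t • T.1 ∈ T₁ ∧ y + t • T.2 ∈ T₂ := by
  have h1 : Continuous fun t : ℝ => x + t • T.1 := by fun_prop
  have h2 : Continuous fun t : ℝ => y + t • T.2 := by fun_prop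
  exact (h1.continuousAt.eventually_mem (by simpa using hF.isOpen_fst.mem_nhds hx)).and
    (h2.continuousAt.eventually_mem (by simpa using hF.isOpen_snd.mem_nhds hy))

/-- The derivative of the metric along a line. -/
theorem deriv_metric {x : E₁} {y : E₂} (hx : x ∈ T₁) (hy : y ∈ T₂) (T u v : E₁ × E₂) {c : ℝ}
    (hc : HasDerivAt (fun t : ℝ => G₁ (x + t • T.1) u.1 v.1
      + ρ (x + t • T.1) ^ 2 * G₂ (y + t • T.2) u.2 v.2) c 0) :
    paraMetric m (fderiv ℝ (fderiv ℝ F) (x, y) T u) (fderiv ℝ F (x, y) v)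
      + paraMetric m (fderiv ℝ F (x, y) u) (fderiv ℝ (fderiv ℝ F) (x, y) T v) = c := by
  have h1 := hasDerivAt_paraMetric (hF.hasDerivAt_fderiv hx hy T u) (hF.hasDerivAt_fderiv hx hy T v)
  have h2 := h1.congr_of_eventuallyEq (f₁ := fun t : ℝ => G₁ (x + t • T.1) u.1 v.1
      + ρ (x + t • T.1) ^ 2 * G₂ (y + t • T.2) u.2 v.2) (by
    filter_upwards [hF.eventually_mem hx hy T] with t ht
    exact (hF.metric _ ht.1 _ ht.2 u v).symm)
  simpa using h2.unique hc

/-- The derivatives of the immersion satisfy the relations of a `𝒫R`-warped product. -/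
theorem isPRJet {x : E₁} {y : E₂} (hx : x ∈ T₁) (hy : y ∈ T₂) :
    IsPRJet (fderiv ℝ F (x, y)).toLinearMap (fderiv ℝ (fderiv ℝ F) (x, y)).toLinearMap₁₂
      (G₁ x) (ρ x ^ 2 • G₂ y) (fderiv ℝ (fun x => Real.log (ρ x)) x).toLinearMap where
  symm u v := (hF.contDiffAt hx hy).isSymmSndFDerivAt (by simp; norm_cast) u v
  metric u v := by simpa using hF.metric x hx y hy u v
  nondegenerate := hF.nondegenerate x hx
  pos Z hZ := by
    have := hF.pos y hy Z hZ
    have := hF.warping_pos x hx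
    simp only [LinearMap.smul_apply, smul_eq_mul]
    positivity
  invariant := hF.invariant x hx y hy
  antiinvariant := hF.antiinvariant x hx y hy
  deriv_mixed T X Z := hF.deriv_metric hx hy T (X, 0) (0, Z) (by simpa using hasDerivAt_const _ _)
  deriv_fst Z X Y := hF.deriv_metric hx hy (0, Z) (X, 0) (Y, 0) (by
    simpa using hasDerivAt_const _ _)
  deriv_snd X Z W := by
    refine hF.deriv_metric hx hy (X, 0) (0, Z) (0, W) ?_
    have hρ : DifferentiableAt ℝ ρ x :=
      (hF.contDiffOn_warping.contDiffAt (hF.isOpen_fst.mem_nhds hx)).differentiableAt (by simp)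
    have h0 := hF.warping_pos x hx
    have h1 : HasDerivAt (fun t : ℝ => x + t • X) X 0 := by
      simpa using ((hasDerivAt_id (0 : ℝ)).smul_const X).const_add x
    have h2 : HasDerivAt (fun t : ℝ => ρ (x + t • X)) (fderiv ℝ ρ x X) 0 :=
      HasFDerivAt.comp_hasDerivAt (0 : ℝ) (by simpa using hρ.hasFDerivAt) h1
    have h3 := (h2.pow 2).mul_const (G₂ y Z W)
    have h4 : fderiv ℝ (fun x => Real.log (ρ x)) x = (ρ x)⁻¹ • fderiv ℝ ρ x :=
      fderiv.log hρ h0.ne'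
    have h5 : 2 * fderiv ℝ (fun x => Real.log (ρ x)) x X * (ρ x ^ 2 * G₂ y Z W) =
        2 * ρ (x + (0 : ℝ) • X) ^ (2 - 1) * fderiv ℝ ρ x X * G₂ y Z W := by
      rw [h4]
      simp
      field_simp
    simp only [map_zero, zero_add, smul_zero, add_zero]
    exact h3.congr_deriv h5.symm
  deriv_antiinvariant T W u := by
    have h1 := hasDerivAt_paraMetric
      (((paraStructure m).toContinuousLinearMap.hasFDerivAt.comp_hasDerivAt (0 : ℝ)
        (hF.hasDerivAt_fderiv hx hy T (0, W)))) (hF.hasDerivAt_fderiv hx hy T u)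
    have h2 := h1.congr_of_eventuallyEq (f₁ := fun _ => 0) (by
      filter_upwards [hF.eventually_mem hx hy T] with t ht
      exact (hF.antiinvariant _ ht.1 _ ht.2 W u).symm)
    simpa using h2.unique (hasDerivAt_const _ _)

end IsLocalPRWarpedProduct

end Local

noncomputable section

/-! ### Partial derivatives -/

namespace IsLocalPRWarpedProduct

variable {E₁ E₂ : Type*} [NormedAddCommGroup E₁] [NormedSpace ℝ E₁]
  [NormedAddCommGroup E₂] [NormedSpace ℝ E₂] {m : ℕ}
  {F : E₁ × E₂ → ParaPlane m} {T₁ : Set E₁} {T₂ : Set E₂}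
  {G₁ : E₁ → LinearMap.BilinForm ℝ E₁} {G₂ : E₂ → LinearMap.BilinForm ℝ E₂} {ρ : E₁ → ℝ}
  (hF : IsLocalPRWarpedProduct F T₁ T₂ G₁ G₂ ρ) {x : E₁} {y : E₂} (hx : x ∈ T₁) (hy : y ∈ T₂)
include hF hx hy

theorem hasFDerivAt_fst : HasFDerivAt (fun x => F (x, y))
    ((fderiv ℝ F (x, y)).comp (ContinuousLinearMap.inl ℝ E₁ E₂)) x :=
  (hF.differentiableAt hx hy).hasFDerivAt.comp x (hasFDerivAt_prodMk_left x y)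

theorem hasFDerivAt_snd : HasFDerivAt (fun y => F (x, y))
    ((fderiv ℝ F (x, y)).comp (ContinuousLinearMap.inr ℝ E₁ E₂)) y :=
  (hF.differentiableAt hx hy).hasFDerivAt.comp y (hasFDerivAt_prodMk_right x y)

theorem fderiv_fderiv_fst (X Y : E₁) :
    fderiv ℝ (fderiv ℝ fun x => F (x, y)) x X Y = fderiv ℝ (fderiv ℝ F) (x, y) (X, 0) (Y, 0) := by
  have h1 : fderiv ℝ (fun x => F (x, y)) =ᶠ[nhds x]
      fun x => (fderiv ℝ F (x, y)).comp (ContinuousLinearMap.inl ℝ E₁ E₂) := by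
    filter_upwards [hF.isOpen_fst.mem_nhds hx] with x' hx'
    exact (hF.hasFDerivAt_fst hx' hy).fderiv
  have h2 : HasFDerivAt (fun x => fderiv ℝ F (x, y)) _ x :=
    (hF.hasFDerivAt_fderiv hx hy).comp x (hasFDerivAt_prodMk_left x y)
  rw [h1.fderiv_eq, (h2.clm_comp (hasFDerivAt_const _ _)).fderiv]
  simp

theorem fderiv_fderiv_snd (Z W : E₂) :
    fderiv ℝ (fderiv ℝ fun y => F (x, y)) y Z W = fderiv ℝ (fderiv ℝ F) (x, y) (0, Z) (0, W) := by
  have h1 : fderiv ℝ (fun y => F (x, y)) =ᶠ[nhds y]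
      fun y => (fderiv ℝ F (x, y)).comp (ContinuousLinearMap.inr ℝ E₁ E₂) := by
    filter_upwards [hF.isOpen_snd.mem_nhds hy] with y' hy'
    exact (hF.hasFDerivAt_snd hx hy').fderiv
  have h2 : HasFDerivAt (fun y => fderiv ℝ F (x, y)) _ y :=
    (hF.hasFDerivAt_fderiv hx hy).comp y (hasFDerivAt_prodMk_right x y)
  rw [h1.fderiv_eq, (h2.clm_comp (hasFDerivAt_const _ _)).fderiv]
  simp

end IsLocalPRWarpedProduct

set_option linter.unusedSectionVars false

/-! ### Charts -/

section Chart

variable {E : Type*} [NormedAddCommGroup E] [NormedSpace ℝ E]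
  {H : Type*} [TopologicalSpace H] {I : ModelWithCorners ℝ E H} [I.Boundaryless]
  {M : Type*} [TopologicalSpace M] [ChartedSpace H M]

/-- The differential of a map between manifolds, as a map between the model vector spaces. -/
def modelDeriv (I : ModelWithCorners ℝ E H) {E' : Type*} [NormedAddCommGroup E']
    [NormedSpace ℝ E'] {H' : Type*} [TopologicalSpace H'] (I' : ModelWithCorners ℝ E' H')
    {M' : Type*} [TopologicalSpace M'] [ChartedSpace H' M'] (φ : M → M') (q : M) : E →L[ℝ] E' :=
  mfderiv I I' φ q

/-- At the centre of a chart, the differential is the derivative of the coordinate expression. -/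
theorem modelDeriv_eq_fderiv {W : Type*} [NormedAddCommGroup W] [NormedSpace ℝ W] {φ : M → W}
    {q : M} (hφ : MDifferentiableAt I 𝓘(ℝ, W) φ q) :
    modelDeriv I 𝓘(ℝ, W) φ q = fderiv ℝ (φ ∘ (extChartAt I q).symm) (extChartAt I q q) := by
  have h1 : HasFDerivWithinAt (φ ∘ (extChartAt I q).symm) (modelDeriv I 𝓘(ℝ, W) φ q) (Set.range I)
      (extChartAt I q q) := hφ.hasMFDerivAt.2
  rw [I.range_eq_univ, hasFDerivWithinAt_univ] at h1
  exact h1.fderiv.symm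

variable [IsManifold I ∞ M]

theorem mdifferentiableAt_extChartAt_symm_of_boundaryless {q : M} {z : E}
    (hz : z ∈ (extChartAt I q).target) :
    MDifferentiableAt 𝓘(ℝ, E) I (extChartAt I q).symm z := by
  have : IsManifold I 1 M := IsManifold.of_le (n := ∞) (by norm_cast)
  have := mdifferentiableWithinAt_extChartAt_symm (I := I) hz
  rwa [I.range_eq_univ, mdifferentiableWithinAt_univ] at this

theorem exists_modelDeriv_extChartAt_symm {q : M} {z : E} (hz : z ∈ (extChartAt I q).target) :
    ∃ e : E ≃L[ℝ] E, modelDeriv 𝓘(ℝ, E) I (extChartAt I q).symm z = e := by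
  have : IsManifold I 1 M := IsManifold.of_le (n := ∞) (by norm_cast)
  have := isInvertible_mfderivWithin_extChartAt_symm (I := I) hz
  rw [I.range_eq_univ, mfderivWithin_univ] at this
  obtain ⟨e, he⟩ := this
  exact ⟨e, he.symm⟩

/-- The metric at a point, as a bilinear form on the model vector space. -/
def PseudoRiemannianMetric.modelForm (g : PseudoRiemannianMetric I M) (x : M) :
    E →L[ℝ] E →L[ℝ] ℝ := g.form x

/-- The coordinate expression of a metric in the chart around `q`. -/
def coordForm (g : PseudoRiemannianMetric I M) (q : M) (z : E) : LinearMap.BilinForm ℝ E :=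
  (g.modelForm ((extChartAt I q).symm z)).toLinearMap₁₂.compl₁₂
    (modelDeriv 𝓘(ℝ, E) I (extChartAt I q).symm z).toLinearMap
    (modelDeriv 𝓘(ℝ, E) I (extChartAt I q).symm z).toLinearMap

theorem coordForm_nondegenerate (g : PseudoRiemannianMetric I M) {q : M} {z : E}
    (hz : z ∈ (extChartAt I q).target) (u : E) (hu : ∀ v, coordForm g q z u v = 0) : u = 0 := by
  obtain ⟨e, he⟩ := exists_modelDeriv_extChartAt_symm (I := I) hz
  have h1 : e u = 0 := by
    refine g.nondegenerate ((extChartAt I q).symm z) (e u) fun (v : E) => ?_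
    have h2 := hu (e.symm v)
    simp only [coordForm, he, LinearMap.compl₁₂_apply, ContinuousLinearMap.coe_coe,
      ContinuousLinearEquiv.coe_coe, e.apply_symm_apply] at h2
    exact h2
  exact e.map_eq_zero_iff.1 h1

theorem coordForm_pos {g : PseudoRiemannianMetric I M} (hg : g.IsSpacelike) {q : M} {z : E}
    (hz : z ∈ (extChartAt I q).target) (u : E) (hu : u ≠ 0) : 0 < coordForm g q z u u := by
  obtain ⟨e, he⟩ := exists_modelDeriv_extChartAt_symm (I := I) hz
  have h2 := hg ((extChartAt I q).symm z) (e u) fun h1 => hu (e.map_eq_zero_iff.1 h1)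
  simp only [coordForm, he, LinearMap.compl₁₂_apply, ContinuousLinearMap.coe_coe,
    ContinuousLinearEquiv.coe_coe]
  exact h2

end Chart

/-! ### Warped products in coordinates -/

section WarpedProduct

variable {E₁ : Type*} [NormedAddCommGroup E₁] [NormedSpace ℝ E₁] [FiniteDimensional ℝ E₁]
  {H₁ : Type*} [TopologicalSpace H₁] {I₁ : ModelWithCorners ℝ E₁ H₁} [I₁.Boundaryless]
  {N₁ : Type*} [TopologicalSpace N₁] [ChartedSpace H₁ N₁] [IsManifold I₁ ∞ N₁]
  {E₂ : Type*} [NormedAddCommGroup E₂] [NormedSpace ℝ E₂] [FiniteDimensional ℝ E₂]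
  {H₂ : Type*} [TopologicalSpace H₂] {I₂ : ModelWithCorners ℝ E₂ H₂} [I₂.Boundaryless]
  {N₂ : Type*} [TopologicalSpace N₂] [ChartedSpace H₂ N₂] [IsManifold I₂ ∞ N₂]
  {m : ℕ}

variable (I₁ I₂) in
/-- The immersion in the product of the charts around the components of `q`. -/
def coordMap (Φ : N₁ × N₂ → ParaPlane m) (q : N₁ × N₂) (z : E₁ × E₂) : ParaPlane m :=
  Φ ((extChartAt I₁ q.1).symm z.1, (extChartAt I₂ q.2).symm z.2)

omit [FiniteDimensional ℝ E₁] [I₁.Boundaryless] [IsManifold I₁ ∞ N₁] [FiniteDimensional ℝ E₂]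
  [I₂.Boundaryless] [IsManifold I₂ ∞ N₂] in
theorem coordMap_eq (Φ : N₁ × N₂ → ParaPlane m) (q : N₁ × N₂) :
    Φ ∘ (extChartAt (I₁.prod I₂) q).symm = coordMap I₁ I₂ Φ q := by
  rw [extChartAt_prod]; rfl

omit [FiniteDimensional ℝ E₁] [FiniteDimensional ℝ E₂] in
/-- The inverse of the product chart. -/
theorem hasMFDerivAt_prod_extChartAt_symm (q : N₁ × N₂) {z : E₁ × E₂}
    (hz₁ : z.1 ∈ (extChartAt I₁ q.1).target) (hz₂ : z.2 ∈ (extChartAt I₂ q.2).target) :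
    HasMFDerivAt 𝓘(ℝ, E₁ × E₂) (I₁.prod I₂)
      (fun z : E₁ × E₂ => ((extChartAt I₁ q.1).symm z.1, (extChartAt I₂ q.2).symm z.2)) z
      (((mfderiv 𝓘(ℝ, E₁) I₁ (extChartAt I₁ q.1).symm z.1).comp
          (ContinuousLinearMap.fst ℝ E₁ E₂)).prod
        ((mfderiv 𝓘(ℝ, E₂) I₂ (extChartAt I₂ q.2).symm z.2).comp
          (ContinuousLinearMap.snd ℝ E₁ E₂))) :=
  (HasMFDerivAt.comp z (mdifferentiableAt_extChartAt_symm_of_boundaryless hz₁).hasMFDerivAt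
      (hasFDerivAt_fst (𝕜 := ℝ) (E := E₁) (F := E₂) (p := z)).hasMFDerivAt).prodMk
    (HasMFDerivAt.comp z (mdifferentiableAt_extChartAt_symm_of_boundaryless hz₂).hasMFDerivAt
      (hasFDerivAt_snd (𝕜 := ℝ) (E := E₁) (F := E₂) (p := z)).hasMFDerivAt)

theorem fderiv_coordMap {Φ : N₁ × N₂ → ParaPlane m}
    (hΦ : ContMDiff (I₁.prod I₂) 𝓘(ℝ, ParaPlane m) ∞ Φ) (q : N₁ × N₂) {x : E₁} {y : E₂}
    (hx : x ∈ (extChartAt I₁ q.1).target) (hy : y ∈ (extChartAt I₂ q.2).target) (u : E₁ × E₂) :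
    fderiv ℝ (coordMap I₁ I₂ Φ q) (x, y) u =
      modelDeriv (I₁.prod I₂) 𝓘(ℝ, ParaPlane m) Φ
        ((extChartAt I₁ q.1).symm x, (extChartAt I₂ q.2).symm y)
        (modelDeriv 𝓘(ℝ, E₁) I₁ (extChartAt I₁ q.1).symm x u.1,
          modelDeriv 𝓘(ℝ, E₂) I₂ (extChartAt I₂ q.2).symm y u.2) := by
  have h1 := HasMFDerivAt.comp (x, y)
    ((hΦ.mdifferentiable (by simp)) ((extChartAt I₁ q.1).symm x,
      (extChartAt I₂ q.2).symm y)).hasMFDerivAt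
    (hasMFDerivAt_prod_extChartAt_symm q (z := (x, y)) hx hy)
  have h2 : HasFDerivAt (coordMap I₁ I₂ Φ q)
      ((modelDeriv (I₁.prod I₂) 𝓘(ℝ, ParaPlane m) Φ
        ((extChartAt I₁ q.1).symm x, (extChartAt I₂ q.2).symm y)).comp
        (((modelDeriv 𝓘(ℝ, E₁) I₁ (extChartAt I₁ q.1).symm x).comp
          (ContinuousLinearMap.fst ℝ E₁ E₂)).prod
        ((modelDeriv 𝓘(ℝ, E₂) I₂ (extChartAt I₂ q.2).symm y).comp
          (ContinuousLinearMap.snd ℝ E₁ E₂)))) (x, y) := hasMFDerivAt_iff_hasFDerivAt.1 h1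
  rw [h2.fderiv]
  rfl

theorem IsPRWarpedProduct.isLocal {g₁ : PseudoRiemannianMetric I₁ N₁}
    {g₂ : PseudoRiemannianMetric I₂ N₂} {f : N₁ → ℝ} {Φ : N₁ × N₂ → ParaPlane m}
    (hΦ : IsPRWarpedProduct g₁ g₂ f Φ) (hg₂ : g₂.IsSpacelike) (q : N₁ × N₂) :
    IsLocalPRWarpedProduct (coordMap I₁ I₂ Φ q) (extChartAt I₁ q.1).target
      (extChartAt I₂ q.2).target (coordForm g₁ q.1) (coordForm g₂ q.2)
      (f ∘ (extChartAt I₁ q.1).symm) where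
  isOpen_fst := isOpen_extChartAt_target q.1
  isOpen_snd := isOpen_extChartAt_target q.2
  contDiffOn := by
    have h1 := hΦ.contMDiff_immersion.comp_contMDiffOn
      (contMDiffOn_extChartAt_symm (I := I₁.prod I₂) (n := ∞) q)
    rw [coordMap_eq, contMDiffOn_iff_contDiffOn, extChartAt_prod] at h1
    exact h1
  contDiffOn_warping :=
    contMDiffOn_iff_contDiffOn.1 (hΦ.contMDiff_warping.comp_contMDiffOn
      (contMDiffOn_extChartAt_symm (I := I₁) (n := ∞) q.1))
  warping_pos x _ := hΦ.warping_pos _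
  metric x hx y hy u v := by
    rw [fderiv_coordMap hΦ.contMDiff_immersion q hx hy,
      fderiv_coordMap hΦ.contMDiff_immersion q hx hy]
    exact hΦ.isometric _ _ _
  nondegenerate x hx := coordForm_nondegenerate g₁ hx
  pos y hy := coordForm_pos hg₂ hy
  invariant x hx y hy X := by
    obtain ⟨e, he⟩ := exists_modelDeriv_extChartAt_symm (I := I₁) hx
    obtain ⟨X', hX'⟩ := hΦ.invariant ((extChartAt I₁ q.1).symm x, (extChartAt I₂ q.2).symm y)
      (modelDeriv 𝓘(ℝ, E₁) I₁ (extChartAt I₁ q.1).symm x X)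
    refine ⟨e.symm X', ?_⟩
    rw [fderiv_coordMap hΦ.contMDiff_immersion q hx hy,
      fderiv_coordMap hΦ.contMDiff_immersion q hx hy]
    simp only [map_zero, he, ContinuousLinearEquiv.coe_coe, e.apply_symm_apply] at hX' ⊢
    exact hX'
  antiinvariant x hx y hy W v := by
    rw [fderiv_coordMap hΦ.contMDiff_immersion q hx hy,
      fderiv_coordMap hΦ.contMDiff_immersion q hx hy]
    simp only [map_zero]
    exact hΦ.antiinvariant _ _ _

end WarpedProduct

end

section WarpedProduct

variable {E₁ : Type*} [NormedAddCommGroup E₁] [NormedSpace ℝ E₁] [FiniteDimensional ℝ E₁]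
  {H₁ : Type*} [TopologicalSpace H₁] {I₁ : ModelWithCorners ℝ E₁ H₁} [I₁.Boundaryless]
  {N₁ : Type*} [TopologicalSpace N₁] [ChartedSpace H₁ N₁] [IsManifold I₁ ∞ N₁]
  {E₂ : Type*} [NormedAddCommGroup E₂] [NormedSpace ℝ E₂] [FiniteDimensional ℝ E₂]
  {H₂ : Type*} [TopologicalSpace H₂] {I₂ : ModelWithCorners ℝ E₂ H₂} [I₂.Boundaryless]
  {N₂ : Type*} [TopologicalSpace N₂] [ChartedSpace H₂ N₂] [IsManifold I₂ ∞ N₂]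
  {m : ℕ} {g₁ : PseudoRiemannianMetric I₁ N₁} {g₂ : PseudoRiemannianMetric I₂ N₂}
  {f : N₁ → ℝ} {Φ : N₁ × N₂ → ParaPlane m}

set_option linter.unusedSectionVars false

namespace IsPRWarpedProduct

variable (hΦ : IsPRWarpedProduct g₁ g₂ f Φ)
include hΦ

theorem contMDiff_fst (y : N₂) : ContMDiff I₁ 𝓘(ℝ, ParaPlane m) ∞ fun x => Φ (x, y) :=
  hΦ.contMDiff_immersion.comp (contMDiff_id.prodMk contMDiff_const)

theorem contMDiff_snd (x : N₁) : ContMDiff I₂ 𝓘(ℝ, ParaPlane m) ∞ fun y => Φ (x, y) :=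
  hΦ.contMDiff_immersion.comp (contMDiff_const.prodMk contMDiff_id)

theorem immersionDeriv_eq (q : N₁ × N₂) : immersionDeriv (I₁.prod I₂) Φ q =
    (fderiv ℝ (coordMap I₁ I₂ Φ q) (extChartAt I₁ q.1 q.1, extChartAt I₂ q.2 q.2)).toLinearMap := by
  have h := modelDeriv_eq_fderiv ((hΦ.contMDiff_immersion.mdifferentiable (by simp)) q)
  rw [coordMap_eq, extChartAt_prod] at h
  exact congrArg ContinuousLinearMap.toLinearMap h

omit hΦ in
theorem secondDerivative_eq (q : N₁ × N₂) : secondDerivative (I₁.prod I₂) Φ q =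
    (fderiv ℝ (fderiv ℝ (coordMap I₁ I₂ Φ q))
      (extChartAt I₁ q.1 q.1, extChartAt I₂ q.2 q.2)).toLinearMap₁₂ := by
  rw [secondDerivative, coordMap_eq, extChartAt_prod]
  rfl

omit hΦ in
theorem functionDeriv_eq {F : N₁ → ℝ} {x : N₁} (hF : MDifferentiableAt I₁ 𝓘(ℝ, ℝ) F x) :
    functionDeriv I₁ x F = (fderiv ℝ (F ∘ (extChartAt I₁ x).symm) (extChartAt I₁ x x)).toLinearMap :=
  congrArg ContinuousLinearMap.toLinearMap (modelDeriv_eq_fderiv hF)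

theorem mdifferentiableAt_warping (x : N₁) : MDifferentiableAt I₁ 𝓘(ℝ, ℝ) f x :=
  hΦ.contMDiff_warping.mdifferentiable (by simp) x

theorem contMDiff_log : ContMDiff I₁ 𝓘(ℝ, ℝ) ∞ fun x => Real.log (f x) := fun x =>
  ContMDiffAt.comp x (Real.contDiffAt_log.2 (hΦ.warping_pos x).ne').contMDiffAt
    (hΦ.contMDiff_warping x)

theorem mdifferentiableAt_log (x : N₁) :
    MDifferentiableAt I₁ 𝓘(ℝ, ℝ) (fun x => Real.log (f x)) x :=
  hΦ.contMDiff_log.mdifferentiable (by simp) x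

theorem functionDeriv_log (x : N₁) :
    functionDeriv I₁ x (fun x => Real.log (f x)) = (f x)⁻¹ • functionDeriv I₁ x f := by
  have h1 := functionDeriv_eq (hΦ.mdifferentiableAt_log x)
  have h2 := functionDeriv_eq (hΦ.mdifferentiableAt_warping x)
  have h3 : DifferentiableAt ℝ (f ∘ (extChartAt I₁ x).symm) (extChartAt I₁ x x) := by
    have := (contMDiffOn_iff_contDiffOn.1 (hΦ.contMDiff_warping.comp_contMDiffOn
      (contMDiffOn_extChartAt_symm (I := I₁) (n := ∞) x))).contDiffAt
        ((isOpen_extChartAt_target x).mem_nhds (mem_extChartAt_target x))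
    exact this.differentiableAt (by simp)
  have h4 : (f ∘ (extChartAt I₁ x).symm) (extChartAt I₁ x x) = f x := by simp
  rw [h1, h2]
  have h5 := fderiv.log h3 (by rw [h4]; exact (hΦ.warping_pos x).ne')
  rw [h4] at h5
  exact congrArg ContinuousLinearMap.toLinearMap h5

theorem isPRJet (hg₂ : g₂.IsSpacelike) (q : N₁ × N₂) :
    IsPRJet (immersionDeriv (I₁.prod I₂) Φ q) (secondDerivative (I₁.prod I₂) Φ q)
      (coordForm g₁ q.1 (extChartAt I₁ q.1 q.1))
      (f q.1 ^ 2 • coordForm g₂ q.2 (extChartAt I₂ q.2 q.2))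
      (functionDeriv I₁ q.1 fun x => Real.log (f x)) := by
  have J := (hΦ.isLocal hg₂ q).isPRJet (mem_extChartAt_target q.1) (mem_extChartAt_target q.2)
  rw [hΦ.immersionDeriv_eq, secondDerivative_eq, functionDeriv_eq (hΦ.mdifferentiableAt_log q.1)]
  have h4 : (f ∘ (extChartAt I₁ q.1).symm) (extChartAt I₁ q.1 q.1) = f q.1 := by simp
  rw [h4] at J
  exact J

omit hΦ in
theorem coordMap_fst (q : N₁ × N₂) : (fun x => Φ (x, q.2)) ∘ (extChartAt I₁ q.1).symm =
    fun x => coordMap I₁ I₂ Φ q (x, extChartAt I₂ q.2 q.2) := by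
  ext1 x; simp [coordMap]

omit hΦ in
theorem coordMap_snd (q : N₁ × N₂) : (fun y => Φ (q.1, y)) ∘ (extChartAt I₂ q.2).symm =
    fun y => coordMap I₁ I₂ Φ q (extChartAt I₁ q.1 q.1, y) := by
  ext1 x; simp [coordMap]

theorem immersionDeriv_fst (hg₂ : g₂.IsSpacelike) (q : N₁ × N₂) (X : E₁) :
    immersionDeriv I₁ (fun x => Φ (x, q.2)) q.1 X = immersionDeriv (I₁.prod I₂) Φ q (X, 0) := by
  have h := modelDeriv_eq_fderiv (((hΦ.contMDiff_fst q.2).mdifferentiable (by simp)) q.1)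
  rw [coordMap_fst (I₂ := I₂), ((hΦ.isLocal hg₂ q).hasFDerivAt_fst (mem_extChartAt_target q.1)
    (mem_extChartAt_target q.2)).fderiv] at h
  rw [hΦ.immersionDeriv_eq]
  exact DFunLike.congr_fun h X

theorem immersionDeriv_snd (hg₂ : g₂.IsSpacelike) (q : N₁ × N₂) (Z : E₂) :
    immersionDeriv I₂ (fun y => Φ (q.1, y)) q.2 Z = immersionDeriv (I₁.prod I₂) Φ q (0, Z) := by
  have h := modelDeriv_eq_fderiv (((hΦ.contMDiff_snd q.1).mdifferentiable (by simp)) q.2)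
  rw [coordMap_snd (I₁ := I₁), ((hΦ.isLocal hg₂ q).hasFDerivAt_snd (mem_extChartAt_target q.1)
    (mem_extChartAt_target q.2)).fderiv] at h
  rw [hΦ.immersionDeriv_eq]
  exact DFunLike.congr_fun h Z

theorem secondDerivative_fst (hg₂ : g₂.IsSpacelike) (q : N₁ × N₂) (X Y : E₁) :
    secondDerivative I₁ (fun x => Φ (x, q.2)) q.1 X Y =
      secondDerivative (I₁.prod I₂) Φ q (X, 0) (Y, 0) := by
  rw [secondDerivative_eq, secondDerivative, coordMap_fst (I₂ := I₂)]
  exact (hΦ.isLocal hg₂ q).fderiv_fderiv_fst (mem_extChartAt_target q.1)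
    (mem_extChartAt_target q.2) X Y

theorem secondDerivative_snd (hg₂ : g₂.IsSpacelike) (q : N₁ × N₂) (Z W : E₂) :
    secondDerivative I₂ (fun y => Φ (q.1, y)) q.2 Z W =
      secondDerivative (I₁.prod I₂) Φ q (0, Z) (0, W) := by
  rw [secondDerivative_eq, secondDerivative, coordMap_snd (I₁ := I₁)]
  exact (hΦ.isLocal hg₂ q).fderiv_fderiv_snd (mem_extChartAt_target q.1)
    (mem_extChartAt_target q.2) Z W

theorem inducedForm_nondegenerate (hg₂ : g₂.IsSpacelike) (q : N₁ × N₂) :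
    (inducedForm (I₁.prod I₂) Φ q).Nondegenerate := (hΦ.isPRJet hg₂ q).metric_nondegenerate

theorem isPseudoRiemannianImmersion_fst (hg₂ : g₂.IsSpacelike) (y : N₂) :
    IsPseudoRiemannianImmersion I₁ fun x => Φ (x, y) := by
  refine ⟨hΦ.contMDiff_fst y, fun x => ?_⟩
  refine nondegenerate_of_symm (fun u v => paraMetric_comm _ _) fun X hX => ?_
  refine (hΦ.isPRJet hg₂ (x, y)).nondegenerate X fun Y => ?_
  have h := hX Y
  rw [inducedForm, LinearMap.compl₁₂_apply, hΦ.immersionDeriv_fst hg₂ (x, y),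
    hΦ.immersionDeriv_fst hg₂ (x, y), (hΦ.isPRJet hg₂ (x, y)).metric_fst] at h
  exact h

theorem isPseudoRiemannianImmersion_snd (hg₂ : g₂.IsSpacelike) (x : N₁) :
    IsPseudoRiemannianImmersion I₂ fun y => Φ (x, y) := by
  refine ⟨hΦ.contMDiff_snd x, fun y => ?_⟩
  refine nondegenerate_of_symm (fun u v => paraMetric_comm _ _) fun Z hZ => ?_
  by_contra hne
  have h := hZ Z
  rw [inducedForm, LinearMap.compl₁₂_apply, hΦ.immersionDeriv_snd hg₂ (x, y),
    (hΦ.isPRJet hg₂ (x, y)).metric_snd] at h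
  exact ((hΦ.isPRJet hg₂ (x, y)).pos Z hne).ne' h

theorem isTotallyGeodesic_fst (hg₂ : g₂.IsSpacelike)
    (hdim : Module.finrank ℝ E₁ + 2 * Module.finrank ℝ E₂ = 2 * m) (y : N₂) :
    IsTotallyGeodesic I₁ fun x => Φ (x, y) := by
  refine ⟨hΦ.isPseudoRiemannianImmersion_fst hg₂ y, fun x => ?_⟩
  ext1 X
  ext1 Y
  obtain ⟨V, hV⟩ := (hΦ.isPRJet hg₂ (x, y)).second_fst hdim X Y
  rw [secondFundamentalForm, LinearMap.compr₂_apply, hΦ.secondDerivative_fst hg₂ (x, y), hV,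
    ← hΦ.immersionDeriv_fst hg₂ (x, y),
    normalPart_immersionDeriv ((hΦ.isPseudoRiemannianImmersion_fst hg₂ y).2 x)]
  rfl

/-- The squared norm of the gradient of a function on the first factor. -/
theorem normSqGradient_fst (hg₂ : g₂.IsSpacelike) (q : N₁ × N₂) {F : N₁ → ℝ}
    (hF : MDifferentiableAt I₁ 𝓘(ℝ, ℝ) F q.1) {n : E₁}
    (hn : ∀ X, coordForm g₁ q.1 (extChartAt I₁ q.1 q.1) n X = functionDeriv I₁ q.1 F X) :
    normSqGradient (I₁.prod I₂) Φ q (fun r => F r.1) =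
      coordForm g₁ q.1 (extChartAt I₁ q.1 q.1) n n := by
  have J := hΦ.isPRJet hg₂ q
  have h1 : ∀ u : E₁ × E₂, functionDeriv (I₁.prod I₂) q (fun r : N₁ × N₂ => F r.1) u =
      functionDeriv I₁ q.1 F u.1 := by
    intro u
    have h2 := HasMFDerivAt.comp (I := I₁.prod I₂) q hF.hasMFDerivAt
      (hasMFDerivAt_fst (I := I₁) (I' := I₂) q)
    exact DFunLike.congr_fun (f := modelDeriv (I₁.prod I₂) 𝓘(ℝ, ℝ) (fun r : N₁ × N₂ => F r.1) q)
      (g := (modelDeriv I₁ 𝓘(ℝ, ℝ) F q.1).comp (ContinuousLinearMap.fst ℝ E₁ E₂)) h2.mfderiv u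
  have h3 : sharp (inducedForm (I₁.prod I₂) Φ q)
      (functionDeriv (I₁.prod I₂) q fun r : N₁ × N₂ => F r.1) = (n, 0) := by
    rw [← sub_eq_zero]
    refine (hΦ.inducedForm_nondegenerate hg₂ q).1 _ fun v => ?_
    rw [map_sub, LinearMap.sub_apply, apply_sharp (hΦ.inducedForm_nondegenerate hg₂ q), h1,
      inducedForm, LinearMap.compl₁₂_apply, J.metric_fst, hn, sub_self]
  rw [normSqGradient, h3, inducedForm, LinearMap.compl₁₂_apply, J.metric_fst]

section Equality

variable (hg₂ : g₂.IsSpacelike)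
  (hdim : Module.finrank ℝ E₁ + 2 * Module.finrank ℝ E₂ = 2 * m) {q : N₁ × N₂}
  (heq : normSqSecondFundamentalForm (I₁.prod I₂) Φ q =
    2 * Module.finrank ℝ E₂ * normSqGradient (I₁.prod I₂) Φ q fun r => Real.log (f r.1))
include hg₂ hdim heq

/-- The second derivatives along the second factor, in the case of equality. -/
theorem secondDerivative_of_eq {n : E₁} (hn : ∀ X,
    coordForm g₁ q.1 (extChartAt I₁ q.1 q.1) n X =
      functionDeriv I₁ q.1 (fun x => Real.log (f x)) X) (Z W : E₂) :
    ∃ V, secondDerivative (I₁.prod I₂) Φ q (0, Z) (0, W) =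
      immersionDeriv (I₁.prod I₂) Φ q (0, V) -
        (f q.1 ^ 2 * coordForm g₂ q.2 (extChartAt I₂ q.2 q.2) Z W) •
          immersionDeriv (I₁.prod I₂) Φ q (n, 0) := by
  have J := hΦ.isPRJet hg₂ q
  have hg := hΦ.inducedForm_nondegenerate hg₂ q
  rw [hΦ.normSqGradient_fst hg₂ q (hΦ.mdifferentiableAt_log q.1) hn] at heq
  exact J.second_snd hdim hn (J.second_snd_anti hdim hn (normalPart (I₁.prod I₂) Φ q)
    (normalPart_immersionDeriv hg)
    (fun W => normalPart_of_isNormalVector hg fun u => J.antiinvariant W u) heq) Z W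

theorem exists_shapeOperator_eq (ξ : ParaPlane m) :
    ∃ c : ℝ, shapeOperator I₂ (fun y => Φ (q.1, y)) q.2 ξ = c • LinearMap.id := by
  have J := hΦ.isPRJet hg₂ q
  have hg := (hΦ.isPseudoRiemannianImmersion_snd hg₂ q.1).2 q.2
  obtain ⟨n, hn⟩ := J.exists_gradient
  refine ⟨-paraMetric m (immersionDeriv (I₁.prod I₂) Φ q (n, 0)) ξ, ?_⟩
  ext1 Z
  rw [← sub_eq_zero]
  refine hg.1 _ fun W => ?_
  obtain ⟨V, hV⟩ := hΦ.secondDerivative_of_eq hg₂ hdim heq hn Z W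
  have hnormal : IsNormalVector I₂ (fun y => Φ (q.1, y)) q.2
      (immersionDeriv (I₁.prod I₂) Φ q (n, 0)) := fun W => by
    rw [hΦ.immersionDeriv_snd hg₂, J.metric_fst, map_zero]
  have h1 : inducedForm I₂ (fun y => Φ (q.1, y)) q.2 Z W =
      f q.1 ^ 2 * coordForm g₂ q.2 (extChartAt I₂ q.2 q.2) Z W := by
    rw [inducedForm, LinearMap.compl₁₂_apply, hΦ.immersionDeriv_snd hg₂, hΦ.immersionDeriv_snd hg₂,
      J.metric_snd]
    rfl
  have h2 : inducedForm I₂ (fun y => Φ (q.1, y)) q.2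
      (shapeOperator I₂ (fun y => Φ (q.1, y)) q.2 ξ Z) W =
      paraMetric m (secondFundamentalForm I₂ (fun y => Φ (q.1, y)) q.2 Z W) ξ :=
    apply_sharp hg _ W
  rw [map_sub, LinearMap.sub_apply, h2, secondFundamentalForm, LinearMap.compr₂_apply,
    hΦ.secondDerivative_snd hg₂, hV, ← hΦ.immersionDeriv_snd hg₂ q V, map_sub,
    normalPart_immersionDeriv hg, map_smul, normalPart_of_isNormalVector hg hnormal, zero_sub,
    LinearMap.smul_apply, map_smul, LinearMap.smul_apply, LinearMap.id_apply, h1, map_neg,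
    map_smul, LinearMap.neg_apply, LinearMap.smul_apply]
  simp only [smul_eq_mul]
  ring

end Equality

end IsPRWarpedProduct

end WarpedProduct

noncomputable section

/-! ### The Gauss equation in coordinates -/

section DirDeriv

variable {n : ℕ} {W : Type*} [NormedAddCommGroup W] [NormedSpace ℝ W]

/-- The partial derivative `∂ᵢ ψ` of a vector-valued function. -/
def coordDeriv (i : Fin n) (ψ : EuclideanSpace ℝ (Fin n) → W) (z : EuclideanSpace ℝ (Fin n)) : W :=
  fderiv ℝ ψ z (EuclideanSpace.single i 1)

variable {T : Set (EuclideanSpace ℝ (Fin n))} {ψ : EuclideanSpace ℝ (Fin n) → W}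
  {z : EuclideanSpace ℝ (Fin n)}

theorem contDiffOn_coordDeriv (hT : IsOpen T) (hψ : ContDiffOn ℝ ∞ ψ T) (i : Fin n) :
    ContDiffOn ℝ ∞ (coordDeriv i ψ) T :=
  (hψ.fderiv_of_isOpen hT (m := ∞) (by simp)).clm_apply contDiffOn_const

theorem coordDeriv_coordDeriv (hT : IsOpen T) (hψ : ContDiffOn ℝ ∞ ψ T) (hz : z ∈ T)
    (i j : Fin n) : coordDeriv i (coordDeriv j ψ) z =
      fderiv ℝ (fderiv ℝ ψ) z (EuclideanSpace.single i 1) (EuclideanSpace.single j 1) := by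
  have h1 : ContDiffAt ℝ ∞ ψ z := hψ.contDiffAt (hT.mem_nhds hz)
  have h2 : DifferentiableAt ℝ (fderiv ℝ ψ) z :=
    (h1.fderiv_right (m := 1) (by norm_cast)).differentiableAt (by simp)
  have h3 : HasFDerivAt (coordDeriv j ψ) _ z :=
    h2.hasFDerivAt.clm_apply (hasFDerivAt_const (EuclideanSpace.single j (1 : ℝ)) z)
  rw [coordDeriv, h3.fderiv]
  simp

theorem coordDeriv_comm (hT : IsOpen T) (hψ : ContDiffOn ℝ ∞ ψ T) (hz : z ∈ T) (i j : Fin n) :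
    coordDeriv i (coordDeriv j ψ) z = coordDeriv j (coordDeriv i ψ) z := by
  rw [coordDeriv_coordDeriv hT hψ hz, coordDeriv_coordDeriv hT hψ hz]
  exact (hψ.contDiffAt (hT.mem_nhds hz)).isSymmSndFDerivAt (by simp; norm_cast) _ _

variable {m : ℕ} {a b : EuclideanSpace ℝ (Fin n) → ParaPlane m}

theorem differentiableAt_paraMetric (ha : DifferentiableAt ℝ a z) (hb : DifferentiableAt ℝ b z) :
    DifferentiableAt ℝ (fun z => paraMetric m (a z) (b z)) z ∧
    ∀ i, partialDeriv i (fun z => paraMetric m (a z) (b z)) z =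
      paraMetric m (coordDeriv i a z) (b z) + paraMetric m (a z) (coordDeriv i b z) := by
  have h := (paraMetric m).toContinuousBilinearMap.hasFDerivAt_of_bilinear
    ha.hasFDerivAt hb.hasFDerivAt
  refine ⟨h.differentiableAt, fun i => ?_⟩
  have h2 : HasFDerivAt (fun z => paraMetric m (a z) (b z)) _ z := h
  rw [partialDeriv, h2.fderiv]
  simp [coordDeriv, add_comm]

theorem partialDeriv_congr {p q : EuclideanSpace ℝ (Fin n) → ℝ} (h : p =ᶠ[nhds z] q) (i : Fin n) :
    partialDeriv i p z = partialDeriv i q z := by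
  rw [partialDeriv, partialDeriv, h.fderiv_eq]

theorem partialDeriv_const_mul (c : ℝ) {p : EuclideanSpace ℝ (Fin n) → ℝ}
    (hp : DifferentiableAt ℝ p z) (i : Fin n) :
    partialDeriv i (fun z => c * p z) z = c * partialDeriv i p z := by
  rw [partialDeriv, partialDeriv, fderiv_const_mul hp]
  simp

theorem partialDeriv_sum_mul {p q : Fin n → EuclideanSpace ℝ (Fin n) → ℝ}
    (hp : ∀ s, DifferentiableAt ℝ (p s) z) (hq : ∀ s, DifferentiableAt ℝ (q s) z) (i : Fin n) :
    partialDeriv i (fun z => ∑ s, p s z * q s z) z =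
      ∑ s, (partialDeriv i (p s) z * q s z + p s z * partialDeriv i (q s) z) := by
  rw [partialDeriv, fderiv_fun_sum fun s _ => (hp s).fun_mul (hq s), sum_apply]
  refine Finset.sum_congr rfl fun s _ => ?_
  rw [fderiv_fun_mul (hp s) (hq s)]
  simp [partialDeriv, add_comm, mul_comm]

theorem differentiableAt_det {N : ℕ} {A : EuclideanSpace ℝ (Fin n) → Matrix (Fin N) (Fin N) ℝ}
    (hA : ∀ i j, DifferentiableAt ℝ (fun z => A z i j) z) :
    DifferentiableAt ℝ (fun z => (A z).det) z := by
  simp only [Matrix.det_apply]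
  refine DifferentiableAt.fun_sum fun σ _ => DifferentiableAt.const_smul ?_ _
  exact (HasFDerivAt.finsetProd fun i _ => (hA (σ i) i).hasFDerivAt).differentiableAt

theorem differentiableAt_matrix_inv {N : ℕ}
    {A : EuclideanSpace ℝ (Fin n) → Matrix (Fin N) (Fin N) ℝ}
    (hA : ∀ i j, DifferentiableAt ℝ (fun z => A z i j) z) (hdet : (A z).det ≠ 0) (i j : Fin N) :
    DifferentiableAt ℝ (fun z => (A z)⁻¹ i j) z := by
  simp only [Matrix.inv_def, Ring.inverse_eq_inv', Matrix.smul_apply, smul_eq_mul,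
    Matrix.adjugate_apply]
  refine DifferentiableAt.mul ((differentiableAt_det hA).inv hdet) (differentiableAt_det ?_)
  intro k l
  simp only [Matrix.updateRow_apply]
  split_ifs
  · exact differentiableAt_const _
  · exact hA _ _

end DirDeriv

section Gauss

set_option linter.unusedSectionVars false

variable {n m : ℕ} {T : Set (EuclideanSpace ℝ (Fin n))}
  {φ : EuclideanSpace ℝ (Fin n) → ParaPlane m} {r : ℝ}
  {G : EuclideanSpace ℝ (Fin n) → Matrix (Fin n) (Fin n) ℝ}
  {Γ : Fin n → Fin n → Fin n → EuclideanSpace ℝ (Fin n) → ℝ}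
  (hT : IsOpen T) (hφ : ContDiffOn ℝ ∞ φ T) (hr : r ≠ 0)
  (hG : ∀ z ∈ T, ∀ i j, paraMetric m (coordDeriv i φ z) (coordDeriv j φ z) = r * G z i j)
  (hdet : ∀ z ∈ T, (G z).det ≠ 0)
  (hΓ : ∀ k i j z, Γ k i j z = (1 / 2) * ∑ l, (G z)⁻¹ k l *
    (partialDeriv i (fun w => G w j l) z + partialDeriv j (fun w => G w i l) z
      - partialDeriv l (fun w => G w i j) z))

include hT hφ

theorem differentiableAt_coordDeriv {z : EuclideanSpace ℝ (Fin n)} (hz : z ∈ T) (i : Fin n) :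
    DifferentiableAt ℝ (coordDeriv i φ) z :=
  ((contDiffOn_coordDeriv hT hφ i).contDiffAt (hT.mem_nhds hz)).differentiableAt (by simp)

theorem differentiableAt_coordDeriv_coordDeriv {z : EuclideanSpace ℝ (Fin n)} (hz : z ∈ T)
    (i j : Fin n) : DifferentiableAt ℝ (coordDeriv i (coordDeriv j φ)) z :=
  ((contDiffOn_coordDeriv hT (contDiffOn_coordDeriv hT hφ j) i).contDiffAt
    (hT.mem_nhds hz)).differentiableAt (by simp)

include hr hG

theorem metric_eventuallyEq {z : EuclideanSpace ℝ (Fin n)} (hz : z ∈ T) (i j : Fin n) :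
    (fun w => G w i j) =ᶠ[nhds z]
      fun w => r⁻¹ * paraMetric m (coordDeriv i φ w) (coordDeriv j φ w) := by
  filter_upwards [hT.mem_nhds hz] with w hw
  rw [hG w hw, inv_mul_cancel_left₀ hr]

theorem metric_differentiableAt {z : EuclideanSpace ℝ (Fin n)} (hz : z ∈ T) (i j : Fin n) :
    DifferentiableAt ℝ (fun w => G w i j) z :=
  (((differentiableAt_paraMetric (differentiableAt_coordDeriv hT hφ hz i)
    (differentiableAt_coordDeriv hT hφ hz j)).1.const_mul r⁻¹).congr_of_eventuallyEq
      (metric_eventuallyEq hT hφ hr hG hz i j))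

theorem partialDeriv_metric {z : EuclideanSpace ℝ (Fin n)} (hz : z ∈ T) (l i j : Fin n) :
    partialDeriv l (fun w => G w i j) z =
      r⁻¹ * (paraMetric m (coordDeriv l (coordDeriv i φ) z) (coordDeriv j φ z)
        + paraMetric m (coordDeriv i φ z) (coordDeriv l (coordDeriv j φ) z)) := by
  have h := differentiableAt_paraMetric (differentiableAt_coordDeriv hT hφ hz i)
    (differentiableAt_coordDeriv hT hφ hz j)
  rw [partialDeriv_congr (metric_eventuallyEq hT hφ hr hG hz i j), partialDeriv_const_mul _ h.1, h.2]

theorem koszul {z : EuclideanSpace ℝ (Fin n)} (hz : z ∈ T) (i j l : Fin n) :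
    partialDeriv i (fun w => G w j l) z + partialDeriv j (fun w => G w i l) z
      - partialDeriv l (fun w => G w i j) z =
      2 * (r⁻¹ * paraMetric m (coordDeriv i (coordDeriv j φ) z) (coordDeriv l φ z)) := by
  rw [partialDeriv_metric hT hφ hr hG hz, partialDeriv_metric hT hφ hr hG hz,
    partialDeriv_metric hT hφ hr hG hz, coordDeriv_comm hT hφ hz j i, coordDeriv_comm hT hφ hz l i,
    coordDeriv_comm hT hφ hz l j,
    paraMetric_comm (coordDeriv j φ z), paraMetric_comm (coordDeriv i φ z)]
  ring

include hdet hΓ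

theorem christoffel_differentiableAt {z : EuclideanSpace ℝ (Fin n)} (hz : z ∈ T) (k i j : Fin n) :
    DifferentiableAt ℝ (Γ k i j) z := by
  have h1 : Γ k i j =ᶠ[nhds z] fun w => (1 / 2) * ∑ l, (G w)⁻¹ k l *
      (2 * (r⁻¹ * paraMetric m (coordDeriv i (coordDeriv j φ) w) (coordDeriv l φ w))) := by
    filter_upwards [hT.mem_nhds hz] with w hw
    rw [hΓ]
    simp only [koszul hT hφ hr hG hw]
  refine DifferentiableAt.congr_of_eventuallyEq ?_ h1
  refine DifferentiableAt.const_mul (DifferentiableAt.fun_sum fun l _ => ?_) _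
  refine DifferentiableAt.mul (differentiableAt_matrix_inv
    (metric_differentiableAt hT hφ hr hG hz) (hdet z hz) k l) ?_
  exact ((differentiableAt_paraMetric (differentiableAt_coordDeriv_coordDeriv hT hφ hz i j)
    (differentiableAt_coordDeriv hT hφ hz l)).1.const_mul _).const_mul _

theorem sum_christoffel_metric {z : EuclideanSpace ℝ (Fin n)} (hz : z ∈ T) (i j l : Fin n) :
    ∑ k, Γ k i j z * G z k l =
      r⁻¹ * paraMetric m (coordDeriv i (coordDeriv j φ) z) (coordDeriv l φ z) := by
  have h1 : ∀ k, Γ k i j z = ∑ s, (G z)⁻¹ k s *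
      (r⁻¹ * paraMetric m (coordDeriv i (coordDeriv j φ) z) (coordDeriv s φ z)) := by
    intro k
    rw [hΓ, Finset.mul_sum]
    refine Finset.sum_congr rfl fun s _ => ?_
    rw [koszul hT hφ hr hG hz]
    ring
  have hsymm : (G z).IsSymm := by
    ext a b
    have h2 := hG z hz a b
    rw [paraMetric_comm, hG z hz b a] at h2
    exact mul_left_cancel₀ hr h2
  have h3 : ∀ s, ∑ k, (G z)⁻¹ k s * G z k l = if s = l then 1 else 0 := by
    intro s
    have h4 : ((G z)⁻¹ * G z) s l = (1 : Matrix (Fin n) (Fin n) ℝ) s l := by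
      rw [Matrix.nonsing_inv_mul _ (hdet z hz).isUnit]
    rw [Matrix.mul_apply, Matrix.one_apply] at h4
    rw [← h4]
    refine Finset.sum_congr rfl fun k _ => ?_
    rw [hsymm.inv.apply s k]
  calc ∑ k, Γ k i j z * G z k l
      = ∑ s, (∑ k, (G z)⁻¹ k s * G z k l) *
        (r⁻¹ * paraMetric m (coordDeriv i (coordDeriv j φ) z) (coordDeriv s φ z)) := by
        simp only [h1, Finset.sum_mul]
        rw [Finset.sum_comm]
        exact Finset.sum_congr rfl fun s _ => Finset.sum_congr rfl fun k _ => by ring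
    _ = _ := by simp only [h3]; simp

/-- The Gauss equation, with `R` the curvature tensor of the metric `G` and `r G` the metric induced
by `φ`. -/
theorem gauss_equation {z : EuclideanSpace ℝ (Fin n)} (hz : z ∈ T) (l a i j : Fin n) :
    ∑ s, G z s l * (partialDeriv i (Γ s j a) z - partialDeriv j (Γ s i a) z
        + ∑ t, (Γ s i t z * Γ t j a z - Γ s j t z * Γ t i a z)) =
      r⁻¹ * (paraMetric m (coordDeriv j (coordDeriv a φ) z) (coordDeriv i (coordDeriv l φ) z)
        - paraMetric m (coordDeriv i (coordDeriv a φ) z) (coordDeriv j (coordDeriv l φ) z))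
      - ∑ s, ∑ t, (Γ s j a z * Γ t i l z - Γ s i a z * Γ t j l z) * G z t s := by
  have hd : ∀ i j a, ∑ s, (partialDeriv i (Γ s j a) z * G z s l
      + Γ s j a z * partialDeriv i (fun w => G w s l) z) =
      r⁻¹ * (paraMetric m (coordDeriv i (coordDeriv j (coordDeriv a φ)) z) (coordDeriv l φ z)
        + paraMetric m (coordDeriv j (coordDeriv a φ) z) (coordDeriv i (coordDeriv l φ) z)) := by
    intro i j a
    have h := differentiableAt_paraMetric (differentiableAt_coordDeriv_coordDeriv hT hφ hz j a)
      (differentiableAt_coordDeriv hT hφ hz l)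
    rw [← h.2, ← partialDeriv_const_mul _ h.1, ← partialDeriv_sum_mul
      (fun s => christoffel_differentiableAt hT hφ hr hG hdet hΓ hz s j a)
      (fun s => metric_differentiableAt hT hφ hr hG hz s l)]
    refine partialDeriv_congr ?_ i
    filter_upwards [hT.mem_nhds hz] with w hw
    exact sum_christoffel_metric hT hφ hr hG hdet hΓ hw j a l
  have hm : ∀ i s, partialDeriv i (fun w => G w s l) z =
      ∑ t, Γ t i s z * G z t l + ∑ t, Γ t i l z * G z t s := by
    intro i s
    rw [partialDeriv_metric hT hφ hr hG hz, sum_christoffel_metric hT hφ hr hG hdet hΓ hz,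
      sum_christoffel_metric hT hφ hr hG hdet hΓ hz, paraMetric_comm (coordDeriv s φ z)]
    ring
  have h1 := hd i j a
  have h2 := hd j i a
  rw [coordDeriv_comm hT (contDiffOn_coordDeriv hT hφ a) hz j i] at h2
  simp only [hm] at h1 h2
  have h3 : r⁻¹ * (paraMetric m (coordDeriv j (coordDeriv a φ) z) (coordDeriv i (coordDeriv l φ) z)
        - paraMetric m (coordDeriv i (coordDeriv a φ) z) (coordDeriv j (coordDeriv l φ) z)) =
      ∑ s, (partialDeriv i (Γ s j a) z * G z s l
        + Γ s j a z * (∑ t, Γ t i s z * G z t l + ∑ t, Γ t i l z * G z t s))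
      - ∑ s, (partialDeriv j (Γ s i a) z * G z s l
        + Γ s i a z * (∑ t, Γ t j s z * G z t l + ∑ t, Γ t j l z * G z t s)) := by
    rw [h1, h2]; ring
  rw [h3]
  have h4 : ∑ s, G z s l * ∑ t, (Γ s i t z * Γ t j a z - Γ s j t z * Γ t i a z) =
      ∑ s, ∑ t, (Γ s j a z * (Γ t i s z * G z t l) - Γ s i a z * (Γ t j s z * G z t l)) := by
    rw [Finset.sum_comm]
    refine Finset.sum_congr rfl fun s _ => ?_
    rw [Finset.mul_sum]
    exact Finset.sum_congr rfl fun t _ => by ring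
  simp only [mul_add, Finset.sum_add_distrib] at h4 ⊢
  rw [h4]
  simp only [Finset.mul_sum, mul_sub, sub_mul, Finset.sum_sub_distrib]
  simp only [mul_assoc, mul_comm (G z _ l)]
  ring

/-- If the map is umbilical at a point, with mean curvature vector `-ν`, its metric has constant
curvature `r ⟨ν, ν⟩` there. -/
theorem sum_metric_curvature_of_umbilical {z : EuclideanSpace ℝ (Fin n)} (hz : z ∈ T)
    {ν : ParaPlane m} (hν : ∀ i, paraMetric m (coordDeriv i φ z) ν = 0)
    (humb : ∀ i j, ∃ V : Fin n → ℝ, coordDeriv i (coordDeriv j φ) z =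
      ∑ s, V s • coordDeriv s φ z - (r * G z i j) • ν) (l a i j : Fin n) :
    ∑ s, G z s l * (partialDeriv i (Γ s j a) z - partialDeriv j (Γ s i a) z
        + ∑ t, (Γ s i t z * Γ t j a z - Γ s j t z * Γ t i a z)) =
      r * paraMetric m ν ν * (G z j a * G z i l - G z i a * G z j l) := by
  have hpair : ∀ j a i l, paraMetric m (coordDeriv j (coordDeriv a φ) z)
      (coordDeriv i (coordDeriv l φ) z) = r * ∑ s, ∑ t, Γ s j a z * Γ t i l z * G z t s
        + r ^ 2 * (G z j a * G z i l) * paraMetric m ν ν := by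
    intro j a i l
    have hs := fun i j l => sum_christoffel_metric hT hφ hr hG hdet hΓ hz i j l
    obtain ⟨V, hV⟩ := humb i l
    have hVν : paraMetric m (coordDeriv j (coordDeriv a φ) z) ν =
        -(r * G z j a) * paraMetric m ν ν := by
      obtain ⟨U, hU⟩ := humb j a
      rw [hU]
      simp [hν, LinearMap.sum_apply]
    have hVΓ : ∀ s, ∑ t, V t * G z t s = ∑ t, Γ t i l z * G z t s := by
      intro s
      rw [hs, hV]
      simp only [map_sub, map_sum, map_smul, LinearMap.sub_apply, LinearMap.sum_apply,
        LinearMap.smul_apply, smul_eq_mul, hG z hz, paraMetric_comm ν, hν, mul_zero, sub_zero]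
      rw [Finset.mul_sum]
      refine Finset.sum_congr rfl fun t _ => ?_
      field_simp
    have hVs : ∀ s, paraMetric m (coordDeriv j (coordDeriv a φ) z) (coordDeriv s φ z) =
        r * ∑ k, Γ k j a z * G z k s := by
      intro s
      rw [hs, mul_inv_cancel_left₀ hr]
    have hGs : ∀ s t, G z s t = G z t s := by
      intro s t
      have h2 := hG z hz s t
      rw [paraMetric_comm, hG z hz t s] at h2
      exact (mul_left_cancel₀ hr h2).symm
    conv_lhs => rw [hV]
    simp only [map_sub, map_sum, map_smul, smul_eq_mul, hVν, hVs]
    have h5 : ∑ t, V t * (r * ∑ k, Γ k j a z * G z k t) =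
        r * ∑ s, Γ s j a z * ∑ t, V t * G z t s := by
      simp only [Finset.mul_sum]
      rw [Finset.sum_comm]
      refine Finset.sum_congr rfl fun s _ => Finset.sum_congr rfl fun t _ => ?_
      rw [hGs s t]; ring
    rw [h5]
    simp only [hVΓ, Finset.mul_sum, mul_assoc]
    ring
  rw [gauss_equation hT hφ hr hG hdet hΓ hz, hpair, hpair]
  simp only [sub_mul, Finset.sum_sub_distrib]
  field_simp
  ring

end Gauss

end

section ConstantCurvature

variable {p : ℕ} {H₂ : Type*} [TopologicalSpace H₂]
  {I₂ : ModelWithCorners ℝ (EuclideanSpace ℝ (Fin p)) H₂} [I₂.Boundaryless]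
  {N₂ : Type*} [TopologicalSpace N₂] [ChartedSpace H₂ N₂] [IsManifold I₂ ∞ N₂]
  {g₂ : PseudoRiemannianMetric I₂ N₂}

omit [I₂.Boundaryless] in
theorem metricCoeff_eq_coordForm (y : N₂) (z : EuclideanSpace ℝ (Fin p)) (i j : Fin p) :
    metricCoeff g₂ y z i j =
      coordForm g₂ y z (EuclideanSpace.single i 1) (EuclideanSpace.single j 1) := rfl

theorem sum_smul_single (V : EuclideanSpace ℝ (Fin p)) :
    ∑ s, V s • EuclideanSpace.single s (1 : ℝ) = V := by
  ext i
  simp [Pi.single_apply]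

theorem det_metricCoeff_ne_zero {y : N₂} {z : EuclideanSpace ℝ (Fin p)}
    (hz : z ∈ (extChartAt I₂ y).target) : (metricCoeff g₂ y z).det ≠ 0 := by
  intro h
  obtain ⟨v, hv, hv0⟩ := Matrix.exists_vecMul_eq_zero_iff.2 h
  refine hv ?_
  have h1 : WithLp.toLp 2 v = 0 := by
    refine coordForm_nondegenerate g₂ hz _ fun w => ?_
    rw [← sum_smul_single (WithLp.toLp 2 v), ← sum_smul_single w]
    simp only [map_sum, map_smul, LinearMap.sum_apply, LinearMap.smul_apply, smul_eq_mul,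
      ← metricCoeff_eq_coordForm]
    refine Finset.sum_eq_zero fun j _ => ?_
    have h2 := congrFun hv0 j
    simp only [Matrix.vecMul, dotProduct, Pi.zero_apply] at h2
    rw [h2, mul_zero]
  simpa using congrArg WithLp.ofLp h1

/-- The Cauchy–Schwarz inequality for two distinct coordinate vectors. -/
theorem metricCoeff_minor_ne_zero (hg₂ : g₂.IsSpacelike) {y : N₂} {z : EuclideanSpace ℝ (Fin p)}
    (hz : z ∈ (extChartAt I₂ y).target) {i j : Fin p} (hij : i ≠ j) :
    metricCoeff g₂ y z j j * metricCoeff g₂ y z i i -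
      metricCoeff g₂ y z i j * metricCoeff g₂ y z j i ≠ 0 := by
  intro h
  have hne : ∀ k : Fin p, EuclideanSpace.single k (1 : ℝ) ≠ 0 := fun k => by simp
  have hj := coordForm_pos hg₂ hz _ (hne j)
  have hu : metricCoeff g₂ y z j j • EuclideanSpace.single i (1 : ℝ)
      - metricCoeff g₂ y z i j • EuclideanSpace.single j (1 : ℝ) ≠ 0 := by
    intro h0
    have h1 := congrArg (fun v : EuclideanSpace ℝ (Fin p) => v i) h0
    simp [hij] at h1
    exact hj.ne' h1
  have h2 := coordForm_pos hg₂ hz _ hu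
  simp only [map_sub, map_smul, LinearMap.sub_apply, LinearMap.smul_apply, smul_eq_mul,
    ← metricCoeff_eq_coordForm] at h2
  have h3 : metricCoeff g₂ y z j j * (metricCoeff g₂ y z j j * metricCoeff g₂ y z i i
      - metricCoeff g₂ y z i j * metricCoeff g₂ y z j i) = 0 := by rw [h, mul_zero]
  nlinarith

variable {E₁ : Type*} [NormedAddCommGroup E₁] [NormedSpace ℝ E₁] [FiniteDimensional ℝ E₁]
  {H₁ : Type*} [TopologicalSpace H₁] {I₁ : ModelWithCorners ℝ E₁ H₁} [I₁.Boundaryless]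
  {N₁ : Type*} [TopologicalSpace N₁] [ChartedSpace H₁ N₁] [IsManifold I₁ ∞ N₁]
  {m : ℕ} {g₁ : PseudoRiemannianMetric I₁ N₁} {f : N₁ → ℝ} {Φ : N₁ × N₂ → ParaPlane m}

/-- If the second factor has constant curvature, the norm of the gradient of the warping function is
determined by it, in the case of equality. -/
theorem IsPRWarpedProduct.normSqGradient_eq_of_constantCurvature
    (hΦ : IsPRWarpedProduct g₁ g₂ f Φ) (hg₂ : g₂.IsSpacelike)
    (hdim : Module.finrank ℝ E₁ + 2 * Module.finrank ℝ (EuclideanSpace ℝ (Fin p)) = 2 * m)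
    {q : N₁ × N₂}
    (heq : normSqSecondFundamentalForm (I₁.prod I₂) Φ q =
      2 * Module.finrank ℝ (EuclideanSpace ℝ (Fin p)) *
        normSqGradient (I₁.prod I₂) Φ q fun r => Real.log (f r.1))
    (hp : 2 ≤ p) {k : ℝ} (hk : HasConstantCurvature g₂ k) :
    normSqGradient (I₁.prod I₂) Φ q (fun r => f r.1) = k := by
  have J := hΦ.isPRJet hg₂ q
  have hF := hΦ.isLocal hg₂ q
  have hfpos := hΦ.warping_pos q.1
  obtain ⟨n, hn⟩ := J.exists_gradient
  have hx := mem_extChartAt_target (I := I₁) q.1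
  have hy := mem_extChartAt_target (I := I₂) q.2
  set x₀ := extChartAt I₁ q.1 q.1 with hx₀
  set y₀ := extChartAt I₂ q.2 q.2 with hy₀
  have hfx : (f ∘ (extChartAt I₁ q.1).symm) x₀ = f q.1 := by simp [hx₀]
  have hφ : ContDiffOn ℝ ∞ (fun y => coordMap I₁ I₂ Φ q (x₀, y)) (extChartAt I₂ q.2).target :=
    hF.contDiffOn.comp (contDiff_prodMk_right x₀).contDiffOn fun y hy => ⟨hx, hy⟩
  have hD : ∀ z ∈ (extChartAt I₂ q.2).target, ∀ i,
      coordDeriv i (fun y => coordMap I₁ I₂ Φ q (x₀, y)) z =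
        fderiv ℝ (coordMap I₁ I₂ Φ q) (x₀, z) (0, EuclideanSpace.single i 1) := by
    intro z hz i
    rw [coordDeriv, (hF.hasFDerivAt_snd hx hz).fderiv]
    rfl
  have hD₀ : ∀ i, coordDeriv i (fun y => coordMap I₁ I₂ Φ q (x₀, y)) y₀ =
      immersionDeriv (I₁.prod I₂) Φ q (0, EuclideanSpace.single i 1) := by
    intro i
    rw [hD y₀ hy, hΦ.immersionDeriv_eq]
    rfl
  have hcurv := sum_metric_curvature_of_umbilical hF.isOpen_snd hφ (pow_ne_zero 2 hfpos.ne')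
    (G := metricCoeff g₂ q.2) (Γ := christoffel g₂ q.2) (fun z hz i j => by
      rw [hD z hz, hD z hz, hF.metric x₀ hx z hz, hfx, metricCoeff_eq_coordForm]
      simp) (fun z hz => det_metricCoeff_ne_zero hz) (fun _ _ _ _ => rfl) hy
    (ν := immersionDeriv (I₁.prod I₂) Φ q (n, 0))
    (fun i => by rw [hD₀, J.metric_snd]; simp)
    (fun i j => by
      obtain ⟨V, hV⟩ := hΦ.secondDerivative_of_eq hg₂ hdim heq hn (EuclideanSpace.single i 1)
        (EuclideanSpace.single j 1)
      refine ⟨V, ?_⟩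
      rw [coordDeriv_coordDeriv hF.isOpen_snd hφ hy, hF.fderiv_fderiv_snd hx hy]
      rw [IsPRWarpedProduct.secondDerivative_eq] at hV
      refine hV.trans ?_
      rw [← metricCoeff_eq_coordForm]
      congr 1
      simp only [hD₀, ← map_smul, ← map_sum]
      congr 1
      conv_lhs => rw [← sum_smul_single V]
      ext1
      · simp [Prod.fst_sum]
      · simp [Prod.snd_sum])
  have h0 : (⟨0, by omega⟩ : Fin p) ≠ ⟨1, by omega⟩ := by simp
  set i : Fin p := ⟨0, by omega⟩
  set j : Fin p := ⟨1, by omega⟩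
  have h1 := hcurv i j i j
  have h2 : ∀ s, partialDeriv i (christoffel g₂ q.2 s j j) y₀
      - partialDeriv j (christoffel g₂ q.2 s i j) y₀
      + ∑ t, (christoffel g₂ q.2 s i t y₀ * christoffel g₂ q.2 t j j y₀
        - christoffel g₂ q.2 s j t y₀ * christoffel g₂ q.2 t i j y₀) =
      k * (metricCoeff g₂ q.2 y₀ j j * (if s = i then 1 else 0)
        - metricCoeff g₂ q.2 y₀ i j * (if s = j then 1 else 0)) := fun s => hk q.2 s j i j
  simp only [h2] at h1
  have h3 : ∑ s, metricCoeff g₂ q.2 y₀ s i * (k * (metricCoeff g₂ q.2 y₀ j j *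
      (if s = i then 1 else 0) - metricCoeff g₂ q.2 y₀ i j * (if s = j then 1 else 0))) =
      k * (metricCoeff g₂ q.2 y₀ j j * metricCoeff g₂ q.2 y₀ i i
        - metricCoeff g₂ q.2 y₀ i j * metricCoeff g₂ q.2 y₀ j i) := by
    simp only [mul_sub, Finset.sum_sub_distrib, mul_ite, mul_one, mul_zero, Finset.sum_ite_eq',
      Finset.mem_univ, if_true]
    ring
  rw [h3] at h1
  have h4 := mul_right_cancel₀ (metricCoeff_minor_ne_zero hg₂ hy h0) h1
  have h5 : ∀ X, coordForm g₁ q.1 x₀ (f q.1 • n) X = functionDeriv I₁ q.1 f X := by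
    intro X
    rw [map_smul, LinearMap.smul_apply, hn, hΦ.functionDeriv_log, LinearMap.smul_apply,
      smul_smul, mul_inv_cancel₀ hfpos.ne', one_smul]
  rw [hΦ.normSqGradient_fst hg₂ q (hΦ.mdifferentiableAt_warping q.1) h5, h4, J.metric_fst]
  simp only [map_smul, LinearMap.smul_apply, smul_eq_mul]
  ring

end ConstantCurvature

/-! ### Local diffeomorphisms and locally constant functions -/

section Chart

variable {E : Type*} [NormedAddCommGroup E] [NormedSpace ℝ E]
  {H : Type*} [TopologicalSpace H] {I : ModelWithCorners ℝ E H} [I.Boundaryless]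
  {M : Type*} [TopologicalSpace M] [ChartedSpace H M]
  {W : Type*} [NormedAddCommGroup W] [NormedSpace ℝ W]

omit [I.Boundaryless] in
/-- A function whose derivative vanishes near a point is constant near that point. -/
theorem eventually_eq_of_hasFDerivAt_zero {ψ : M → W} {x : M}
    (h : ∀ᶠ z in nhds (extChartAt I x x),
      HasFDerivAt (ψ ∘ (extChartAt I x).symm) (0 : E →L[ℝ] W) z) :
    ∀ᶠ x' in nhds x, ψ x' = ψ x := by
  obtain ⟨r, hr, hball⟩ := Metric.eventually_nhds_iff_ball.1 h
  have h1 : ∀ᶠ x' in nhds x, extChartAt I x x' ∈ Metric.ball (extChartAt I x x) r :=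
    (continuousAt_extChartAt x).eventually_mem (Metric.ball_mem_nhds _ hr)
  filter_upwards [h1, extChartAt_source_mem_nhds (I := I) x] with x' hx' hs
  have h2 := Metric.isOpen_ball.is_const_of_fderiv_eq_zero (𝕜 := ℝ)
    (convex_ball (extChartAt I x x) r).isPreconnected
    (fun z hz => (hball z hz).differentiableAt.differentiableWithinAt)
    (fun z hz => (hball z hz).fderiv) hx' (Metric.mem_ball_self hr)
  rwa [Function.comp_apply, Function.comp_apply, (extChartAt I x).left_inv hs,
    extChartAt_to_inv] at h2

variable [IsManifold I ∞ M] [FiniteDimensional ℝ E] [FiniteDimensional ℝ W]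

/-- The inverse function theorem on a manifold. -/
theorem isLocalDiffeomorph_of_injective {ψ : M → W} (hψ : ContMDiff I 𝓘(ℝ, W) ∞ ψ)
    (hinj : ∀ x, Function.Injective (modelDeriv I 𝓘(ℝ, W) ψ x))
    (hdim : Module.finrank ℝ E = Module.finrank ℝ W) : IsLocalDiffeomorph I 𝓘(ℝ, W) ∞ ψ := by
  intro x
  have : CompleteSpace E := FiniteDimensional.complete ℝ E
  set F := ψ ∘ (extChartAt I x).symm with hF
  have hcd : ContDiffOn ℝ ∞ F (extChartAt I x).target :=
    contMDiffOn_iff_contDiffOn.1 (hψ.comp_contMDiffOn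
      (contMDiffOn_extChartAt_symm (I := I) (n := ∞) x))
  have hopen := isOpen_extChartAt_target (I := I) x
  have hderiv : ∀ z ∈ (extChartAt I x).target, ∃ e : E ≃L[ℝ] W, HasFDerivAt F (e : E →L[ℝ] W) z := by
    intro z hz
    obtain ⟨e, he⟩ := exists_modelDeriv_extChartAt_symm (I := I) hz
    have h1 : HasFDerivAt F ((modelDeriv I 𝓘(ℝ, W) ψ ((extChartAt I x).symm z)).comp
        (modelDeriv 𝓘(ℝ, E) I (extChartAt I x).symm z)) z :=
      hasMFDerivAt_iff_hasFDerivAt.1 (HasMFDerivAt.comp z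
        (hψ.mdifferentiable (by simp) ((extChartAt I x).symm z)).hasMFDerivAt
        (mdifferentiableAt_extChartAt_symm_of_boundaryless hz).hasMFDerivAt)
    rw [he] at h1
    let L := LinearEquiv.ofInjectiveOfFinrankEq
      (modelDeriv I 𝓘(ℝ, W) ψ ((extChartAt I x).symm z)).toLinearMap (hinj _) hdim
    refine ⟨e.trans L.toContinuousLinearEquiv, ?_⟩
    convert h1 using 1
    ext v
    rfl
  obtain ⟨e₀, he₀⟩ := hderiv _ (mem_extChartAt_target x)
  have hc₀ := hcd.contDiffAt (hopen.mem_nhds (mem_extChartAt_target x))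
  let L := hc₀.toOpenPartialHomeomorph F he₀ (by simp)
  have hLF : ∀ z, L z = F z := fun _ => rfl
  let Ψ : PartialDiffeomorph I 𝓘(ℝ, W) M W ∞ :=
    { (extChartAt I x).trans L.toPartialEquiv with
      open_source := by
        rw [PartialEquiv.trans_source]
        exact isOpen_extChartAt_preimage' x L.open_source
      open_target := by
        rw [PartialEquiv.trans_target]
        exact L.symm.isOpen_inter_preimage hopen
      contMDiffOn_toFun := by
        refine hψ.contMDiffOn.congr fun x' hx' => ?_
        have hs : x' ∈ (extChartAt I x).source := hx'.1
        change F (extChartAt I x x') = ψ x'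
        rw [hF, Function.comp_apply, (extChartAt I x).left_inv hs]
      contMDiffOn_invFun := by
        refine (contMDiffOn_extChartAt_symm (I := I) (n := ∞) x).comp
          (t := (extChartAt I x).target) (contMDiffOn_iff_contDiffOn.2 ?_) fun w hw => hw.2
        intro w hw
        have hw1 : w ∈ L.target := hw.1
        have hw2 : L.symm w ∈ (extChartAt I x).target := hw.2
        obtain ⟨e, he⟩ := hderiv _ hw2
        exact (L.contDiffAt_symm hw1 he (hcd.contDiffAt (hopen.mem_nhds hw2))).contDiffWithinAt }
  refine ⟨Ψ, ⟨mem_extChartAt_source x, hc₀.mem_toOpenPartialHomeomorph_source he₀ (by simp)⟩,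
    fun x' hx' => ?_⟩
  have hs : x' ∈ (extChartAt I x).source := hx'.1
  change ψ x' = F (extChartAt I x x')
  rw [hF, Function.comp_apply, (extChartAt I x).left_inv hs]

end Chart

/-! ### Isometries preserving the para-Kähler structure -/

section Rigid

/-- The projection of the para-Kähler `(h + p)`-plane to the para-Kähler `h`-plane. -/
def paraProjection (h p : ℕ) : ParaPlane (h + p) →ₗ[ℝ] ParaPlane h :=
  (LinearMap.funLeft ℝ ℝ (Fin.castAdd p)).prodMap (LinearMap.funLeft ℝ ℝ (Fin.castAdd p))

theorem eq_paraInclusion_paraProjection {h p : ℕ} {v : ParaPlane (h + p)}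
    (h₁ : ∀ j : Fin p, v.1 (Fin.natAdd h j) = 0) (h₂ : ∀ j : Fin p, v.2 (Fin.natAdd h j) = 0) :
    v = paraInclusion h p (paraProjection h p v) := by
  ext i
  · refine Fin.addCases (fun j => ?_) (fun j => ?_) i
    · simp [paraInclusion, paraProjection, LinearMap.funLeft_apply]
    · simp [paraInclusion, h₁]
  · refine Fin.addCases (fun j => ?_) (fun j => ?_) i
    · simp [paraInclusion, paraProjection, LinearMap.funLeft_apply]
    · simp [paraInclusion, h₂]

/-- The metric in null coordinates. -/
theorem paraMetric_eq_null {m : ℕ} (v w : ParaPlane m) :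
    paraMetric m v w = -(1 / 2) * ((v.1 + v.2) ⬝ᵥ (w.1 - w.2) + (v.1 - v.2) ⬝ᵥ (w.1 + w.2)) := by
  simp only [paraMetric_apply, dotProduct, ← Finset.sum_add_distrib, Finset.mul_sum,
    ← Finset.sum_neg_distrib]
  refine Finset.sum_congr rfl fun i _ => ?_
  simp only [Pi.add_apply, Pi.sub_apply]
  ring

/-- A basis of `ℝᵐ` determines an isometry of the para-Kähler plane. -/
theorem exists_isometry_of_basis {m : ℕ} (e : Module.Basis (Fin m) ℝ (Fin m → ℝ)) :
    ∃ A : ParaPlane m ≃ₗ[ℝ] ParaPlane m,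
      (∀ v w, paraMetric m (A v) (A w) = paraMetric m v w) ∧
      (∀ v, A (paraStructure m v) = paraStructure m (A v)) ∧
      ∀ v i, (A v).1 i + (A v).2 i = e.repr (v.1 + v.2) i ∧
        (A v).1 i - (A v).2 i = (v.1 - v.2) ⬝ᵥ e i := by
  let S : (Fin m → ℝ) →ₗ[ℝ] (Fin m → ℝ) := e.equivFun.toLinearMap
  let S' : (Fin m → ℝ) →ₗ[ℝ] (Fin m → ℝ) :=
    { toFun := fun β i => β ⬝ᵥ e i
      map_add' := fun β γ => by ext i; simp [add_dotProduct]
      map_smul' := fun c β => by ext i; simp [smul_dotProduct] }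
  let sumMap : ParaPlane m →ₗ[ℝ] (Fin m → ℝ) := LinearMap.fst ℝ _ _ + LinearMap.snd ℝ _ _
  let diffMap : ParaPlane m →ₗ[ℝ] (Fin m → ℝ) := LinearMap.fst ℝ _ _ - LinearMap.snd ℝ _ _
  let A₀ : ParaPlane m →ₗ[ℝ] ParaPlane m :=
    ((1 / 2 : ℝ) • (S ∘ₗ sumMap + S' ∘ₗ diffMap)).prod ((1 / 2 : ℝ) • (S ∘ₗ sumMap - S' ∘ₗ diffMap))
  have hadd : ∀ v, (A₀ v).1 + (A₀ v).2 = S (v.1 + v.2) := by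
    intro v
    change (1 / 2 : ℝ) • (S (v.1 + v.2) + S' (v.1 - v.2)) +
      (1 / 2 : ℝ) • (S (v.1 + v.2) - S' (v.1 - v.2)) = _
    module
  have hsub : ∀ v, (A₀ v).1 - (A₀ v).2 = S' (v.1 - v.2) := by
    intro v
    change (1 / 2 : ℝ) • (S (v.1 + v.2) + S' (v.1 - v.2)) -
      (1 / 2 : ℝ) • (S (v.1 + v.2) - S' (v.1 - v.2)) = _
    module
  have hpair : ∀ α β, S α ⬝ᵥ S' β = α ⬝ᵥ β := by
    intro α β
    conv_rhs => rw [← e.sum_equivFun α, sum_dotProduct]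
    simp only [smul_dotProduct, smul_eq_mul]
    exact Finset.sum_congr rfl fun i _ => congrArg (S α i * ·) (dotProduct_comm β (e i))
  have hiso : ∀ v w, paraMetric m (A₀ v) (A₀ w) = paraMetric m v w := by
    intro v w
    rw [paraMetric_eq_null, paraMetric_eq_null, hadd, hsub, hadd, hsub, hpair,
      dotProduct_comm (S' _), hpair, dotProduct_comm (w.1 + w.2)]
  have hinj : Function.Injective A₀ := by
    rw [injective_iff_map_eq_zero]
    intro v hv
    refine eq_zero_of_paraMetric_left fun w => ?_
    rw [← hiso, hv, map_zero, LinearMap.zero_apply]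
  refine ⟨LinearEquiv.ofInjectiveEndo A₀ hinj, hiso, fun v => ?_, fun v i =>
    ⟨congrFun (hadd v) i, congrFun (hsub v) i⟩⟩
  change ((1 / 2 : ℝ) • (S (v.2 + v.1) + S' (v.2 - v.1)),
    (1 / 2 : ℝ) • (S (v.2 + v.1) - S' (v.2 - v.1))) =
    ((1 / 2 : ℝ) • (S (v.1 + v.2) - S' (v.1 - v.2)),
      (1 / 2 : ℝ) • (S (v.1 + v.2) + S' (v.1 - v.2)))
  rw [add_comm v.2, ← neg_sub v.1 v.2, map_neg, ← sub_eq_add_neg, sub_neg_eq_add]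

/-- The orthogonal complement of a nondegenerate anti-invariant subspace and of its image by the
para-Kähler structure can be moved to the standard para-Kähler `h`-plane. -/
theorem exists_isometry_to_paraInclusion {h p : ℕ} {E₂ : Type*} [AddCommGroup E₂] [Module ℝ E₂]
    [FiniteDimensional ℝ E₂] (hp : Module.finrank ℝ E₂ = p) (L : E₂ →ₗ[ℝ] ParaPlane (h + p))
    (hL : ∀ w, w ≠ 0 → paraMetric (h + p) (L w) (L w) ≠ 0) :
    ∃ A : ParaPlane (h + p) ≃ₗ[ℝ] ParaPlane (h + p),
      (∀ v w, paraMetric (h + p) (A v) (A w) = paraMetric (h + p) v w) ∧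
      (∀ v, A (paraStructure (h + p) v) = paraStructure (h + p) (A v)) ∧
      ∀ v, (∀ w, paraMetric (h + p) (L w) v = 0) →
        (∀ w, paraMetric (h + p) (paraStructure (h + p) (L w)) v = 0) →
        A v = paraInclusion h p (paraProjection h p (A v)) := by
  let a : E₂ →ₗ[ℝ] (Fin (h + p) → ℝ) := (LinearMap.fst ℝ _ _ + LinearMap.snd ℝ _ _) ∘ₗ L
  let b : E₂ →ₗ[ℝ] (Fin (h + p) → ℝ) := (LinearMap.fst ℝ _ _ - LinearMap.snd ℝ _ _) ∘ₗ L
  have hab : ∀ w, w ≠ 0 → b w ⬝ᵥ a w ≠ 0 := by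
    intro w hw h0
    refine hL w hw ?_
    rw [paraMetric_eq_null]
    change -(1 / 2) * (a w ⬝ᵥ b w + b w ⬝ᵥ a w) = 0
    rw [dotProduct_comm (a w), h0]; simp
  let D : (Fin (h + p) → ℝ) →ₗ[ℝ] Module.Dual ℝ E₂ := (dotProductBilin ℝ ℝ ∘ₗ b).flip
  have hD : ∀ u w, D u w = b w ⬝ᵥ u := fun _ _ => rfl
  let C : LinearMap.ker D × E₂ →ₗ[ℝ] (Fin (h + p) → ℝ) := (LinearMap.ker D).subtype.coprod a
  have hC : ∀ k w, C (k, w) = k + a w := fun _ _ => rfl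
  have hCinj : Function.Injective C := by
    rw [injective_iff_map_eq_zero]
    rintro ⟨k, w⟩ hkw
    rw [hC] at hkw
    have hw : w = 0 := by
      by_contra hne
      refine hab w hne ?_
      have h1 : b w ⬝ᵥ (k : Fin (h + p) → ℝ) = 0 := by
        rw [← hD, LinearMap.mem_ker.1 k.2]; rfl
      have h2 := congrArg (fun u => b w ⬝ᵥ u) hkw
      simpa [dotProduct_add, h1] using h2
    subst hw
    rw [map_zero, add_zero] at hkw
    simpa using hkw
  have hrank := LinearMap.finrank_range_add_finrank_ker D
  have hle : Module.finrank ℝ (LinearMap.range D) ≤ p :=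
    (Submodule.finrank_le _).trans_eq (Subspace.dual_finrank_eq.trans hp)
  have hle' := LinearMap.finrank_le_finrank_of_injective hCinj
  rw [Module.finrank_prod, hp] at hle'
  simp only [Module.finrank_fintype_fun_eq_card, Fintype.card_fin] at hrank hle'
  have hker : Module.finrank ℝ (LinearMap.ker D) = h := by omega
  let C' := LinearEquiv.ofInjectiveOfFinrankEq C hCinj (by
    rw [Module.finrank_prod, hp, hker]; simp)
  let e : Module.Basis (Fin (h + p)) ℝ (Fin (h + p) → ℝ) :=
    (((Module.finBasisOfFinrankEq ℝ _ hker).prod (Module.finBasisOfFinrankEq ℝ _ hp)).map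
      C').reindex finSumFinEquiv
  obtain ⟨A, hiso, hstr, hA⟩ := exists_isometry_of_basis e
  refine ⟨A, hiso, hstr, fun v h₁ h₂ => ?_⟩
  have hnull : ∀ w, b w ⬝ᵥ (v.1 + v.2) = 0 ∧ a w ⬝ᵥ (v.1 - v.2) = 0 := by
    intro w
    have h3 := h₁ w
    have h4 := h₂ w
    rw [paraMetric_eq_null] at h3 h4
    change -(1 / 2) * (a w ⬝ᵥ (v.1 - v.2) + b w ⬝ᵥ (v.1 + v.2)) = 0 at h3
    have h5 : -(1 / 2) * (a w ⬝ᵥ (v.1 - v.2) + (-b w) ⬝ᵥ (v.1 + v.2)) = 0 := by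
      convert h4 using 4
      · change (L w).1 + (L w).2 = (L w).2 + (L w).1
        exact add_comm _ _
      · change -((L w).1 - (L w).2) = (L w).2 - (L w).1
        exact neg_sub _ _
    rw [neg_dotProduct] at h5
    constructor <;> linarith
  have hsum : ∀ j : Fin p, e.repr (v.1 + v.2) (Fin.natAdd h j) = 0 := by
    intro j
    have hk : v.1 + v.2 ∈ LinearMap.ker D := by
      rw [LinearMap.mem_ker]
      ext w
      exact (hnull w).1
    have h3 : C'.symm (v.1 + v.2) = (⟨v.1 + v.2, hk⟩, 0) := by
      rw [LinearEquiv.symm_apply_eq]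
      change _ = C _
      rw [hC, map_zero, add_zero]
    simp [e, h3]
  have hdiff : ∀ j : Fin p, (v.1 - v.2) ⬝ᵥ e (Fin.natAdd h j) = 0 := by
    intro j
    have h3 : e (Fin.natAdd h j) = a (Module.finBasisOfFinrankEq ℝ _ hp j) := by
      simp only [e, Module.Basis.reindex_apply, finSumFinEquiv_symm_apply_natAdd,
        Module.Basis.map_apply]
      change C _ = _
      simp [Module.Basis.prod_apply, hC]
    rw [h3, dotProduct_comm]
    exact (hnull _).2
  refine eq_paraInclusion_paraProjection (fun j => ?_) fun j => ?_
  · have := hA v (Fin.natAdd h j)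
    rw [hsum, hdiff] at this
    linarith [this.1, this.2]
  · have := hA v (Fin.natAdd h j)
    rw [hsum, hdiff] at this
    linarith [this.1, this.2]

end Rigid

section Congruence

variable {E₁ : Type*} [NormedAddCommGroup E₁] [NormedSpace ℝ E₁] [FiniteDimensional ℝ E₁]
  {H₁ : Type*} [TopologicalSpace H₁] {I₁ : ModelWithCorners ℝ E₁ H₁} [I₁.Boundaryless]
  {N₁ : Type*} [TopologicalSpace N₁] [ChartedSpace H₁ N₁] [IsManifold I₁ ∞ N₁]
  {E₂ : Type*} [NormedAddCommGroup E₂] [NormedSpace ℝ E₂] [FiniteDimensional ℝ E₂]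
  {H₂ : Type*} [TopologicalSpace H₂] {I₂ : ModelWithCorners ℝ E₂ H₂} [I₂.Boundaryless]
  {N₂ : Type*} [TopologicalSpace N₂] [ChartedSpace H₂ N₂] [IsManifold I₂ ∞ N₂]
  {m : ℕ} {g₁ : PseudoRiemannianMetric I₁ N₁} {g₂ : PseudoRiemannianMetric I₂ N₂}
  {f : N₁ → ℝ} {Φ : N₁ × N₂ → ParaPlane m}

variable (I₁ I₂) in
/-- The null vector `w + s 𝒫 w`, for `s = ± 1` and `w` the image of a vector tangent to the second
factor. -/
noncomputable def nullVector (Φ : N₁ × N₂ → ParaPlane m) (y : N₂) (e : E₂) (s : ℝ) (x : N₁) :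
    ParaPlane m :=
  immersionDeriv (I₁.prod I₂) Φ (x, y) (0, e)
    + s • paraStructure m (immersionDeriv (I₁.prod I₂) Φ (x, y) (0, e))

namespace IsPRWarpedProduct

variable (hΦ : IsPRWarpedProduct g₁ g₂ f Φ) (hg₂ : g₂.IsSpacelike)
include hΦ hg₂

theorem immersionDeriv_snd_chart (x : N₁) (y : N₂) (e : E₂) {z : E₁}
    (hz : z ∈ (extChartAt I₁ x).target) :
    immersionDeriv (I₁.prod I₂) Φ ((extChartAt I₁ x).symm z, y) (0, e) =
      fderiv ℝ (coordMap I₁ I₂ Φ (x, y)) (z, extChartAt I₂ y y) (0, e) := by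
  have h := modelDeriv_eq_fderiv
    (((hΦ.contMDiff_snd ((extChartAt I₁ x).symm z)).mdifferentiable (by simp)) y)
  have h1 : (fun y => Φ ((extChartAt I₁ x).symm z, y)) ∘ (extChartAt I₂ y).symm =
      fun y' => coordMap I₁ I₂ Φ (x, y) (z, y') := rfl
  rw [h1, ((hΦ.isLocal hg₂ (x, y)).hasFDerivAt_snd hz (mem_extChartAt_target y)).fderiv] at h
  rw [← hΦ.immersionDeriv_snd hg₂ ((extChartAt I₁ x).symm z, y)]
  exact DFunLike.congr_fun h e

theorem nullVector_chart (x : N₁) (y : N₂) (e : E₂) (s : ℝ) {z : E₁}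
    (hz : z ∈ (extChartAt I₁ x).target) :
    nullVector I₁ I₂ Φ y e s ((extChartAt I₁ x).symm z) =
      fderiv ℝ (coordMap I₁ I₂ Φ (x, y)) (z, extChartAt I₂ y y) (0, e) + s • paraStructure m
        (fderiv ℝ (coordMap I₁ I₂ Φ (x, y)) (z, extChartAt I₂ y y) (0, e)) := by
  rw [nullVector, hΦ.immersionDeriv_snd_chart hg₂ x y e hz]

theorem paraMetric_nullVector_pos (x : N₁) (y : N₂) {e : E₂} (he : e ≠ 0) (s : ℝ) :
    0 < paraMetric m (immersionDeriv (I₁.prod I₂) Φ (x, y) (0, e))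
      (nullVector I₁ I₂ Φ y e s x) := by
  have J := hΦ.isPRJet hg₂ (x, y)
  rw [nullVector, map_add, map_smul, paraMetric_comm _ (paraStructure m _), J.antiinvariant,
    J.metric_snd, smul_zero, add_zero]
  exact J.pos e he

/-- The line spanned by a null vector tangent to the fibre and its image by the para-Kähler
structure is locally constant along the first factor. -/
theorem eventually_span_nullVector
    (hdim : Module.finrank ℝ E₁ + 2 * Module.finrank ℝ E₂ = 2 * m)
    (y : N₂) (e : E₂) {s : ℝ} (hs : s * s = 1) (x : N₁) :
    ∀ᶠ x' in nhds x, Submodule.span ℝ {nullVector I₁ I₂ Φ y e s x'} =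
      Submodule.span ℝ {nullVector I₁ I₂ Φ y e s x} := by
  by_cases he : e = 0
  · subst he
    have h0 : ∀ x, nullVector I₁ I₂ Φ y (0 : E₂) s x = 0 := by
      intro x
      rw [nullVector, show ((0 : E₁), (0 : E₂)) = 0 from rfl, map_zero, map_zero, smul_zero,
        add_zero]
    simp [h0]
  have hF := hΦ.isLocal hg₂ (x, y)
  have hy := mem_extChartAt_target (I := I₂) y
  have hx := mem_extChartAt_target (I := I₁) x
  set y₀ := extChartAt I₂ y y
  set v := nullVector I₁ I₂ Φ y e s with hv
  let l : ParaPlane m →L[ℝ] ℝ := LinearMap.toContinuousLinearMap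
    (paraMetric m (immersionDeriv (I₁.prod I₂) Φ (x, y) (0, e)))
  have hl : ∀ w, l w = paraMetric m (immersionDeriv (I₁.prod I₂) Φ (x, y) (0, e)) w := fun _ => rfl
  let Q : ParaPlane m →L[ℝ] ParaPlane m :=
    ContinuousLinearMap.id ℝ _ + s • (paraStructure m).toContinuousLinearMap
  have hQ : ∀ w, Q w = w + s • paraStructure m w := fun _ => rfl
  have hderiv : ∀ z ∈ (extChartAt I₁ x).target, ∃ α : E₁ →L[ℝ] ℝ,
      HasFDerivAt (v ∘ (extChartAt I₁ x).symm)
        (α.smulRight (v ((extChartAt I₁ x).symm z))) z := by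
    intro z hz
    have J := hF.isPRJet hz hy
    have h1 : HasFDerivAt (fun z => fderiv ℝ (coordMap I₁ I₂ Φ (x, y)) (z, y₀)) _ z :=
      (hF.hasFDerivAt_fderiv hz hy).comp z (hasFDerivAt_prodMk_left z y₀)
    have h2 := Q.hasFDerivAt.comp z (h1.clm_apply (hasFDerivAt_const ((0 : E₁), e) z))
    have h3 : v ∘ (extChartAt I₁ x).symm =ᶠ[nhds z]
        Q ∘ fun z => fderiv ℝ (coordMap I₁ I₂ Φ (x, y)) (z, y₀) (0, e) := by
      filter_upwards [hF.isOpen_fst.mem_nhds hz] with z' hz'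
      exact hΦ.nullVector_chart hg₂ x y e s hz'
    have h4 := h2.congr_of_eventuallyEq h3
    have hpos := hΦ.paraMetric_nullVector_pos hg₂ ((extChartAt I₁ x).symm z) y he s
    let l' : ParaPlane m →L[ℝ] ℝ := LinearMap.toContinuousLinearMap (paraMetric m
      (immersionDeriv (I₁.prod I₂) Φ ((extChartAt I₁ x).symm z, y) (0, e)))
    have hl' : l' (v ((extChartAt I₁ x).symm z)) ≠ 0 := hpos.ne'
    refine ⟨(l' (v ((extChartAt I₁ x).symm z)))⁻¹ • l'.comp
      (fderiv ℝ (v ∘ (extChartAt I₁ x).symm) z), ?_⟩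
    refine h4.differentiableAt.hasFDerivAt.congr_fderiv ?_
    ext1 X
    obtain ⟨c, hc⟩ := J.second_mixed_null hdim hs X
    have h5 : fderiv ℝ (v ∘ (extChartAt I₁ x).symm) z X = c • v ((extChartAt I₁ x).symm z) := by
      rw [h4.fderiv, hv, hΦ.nullVector_chart hg₂ x y e s hz]
      refine Eq.trans ?_ (hc e)
      simp [hQ]
    rw [ContinuousLinearMap.smulRight_apply]
    simp only [smul_apply, ContinuousLinearMap.comp_apply, h5, map_smul, smul_eq_mul]
    rw [mul_left_comm, inv_mul_cancel₀ hl', mul_one]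
  have hcont : ContinuousAt (v ∘ (extChartAt I₁ x).symm) (extChartAt I₁ x x) :=
    (hderiv _ hx).choose_spec.continuousAt
  have hpos : 0 < l (v x) := hΦ.paraMetric_nullVector_pos hg₂ x y he s
  have hne : ∀ᶠ z in nhds (extChartAt I₁ x x), 0 < l ((v ∘ (extChartAt I₁ x).symm) z) := by
    refine (l.continuous.continuousAt.comp hcont).eventually (lt_mem_nhds ?_)
    simpa using hpos
  have hconst := eventually_eq_of_hasFDerivAt_zero (I := I₁) (ψ := fun x' => (l (v x'))⁻¹ • v x')
    (x := x) (by
      filter_upwards [hne, hF.isOpen_fst.mem_nhds hx] with z hz hzT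
      obtain ⟨α, hα⟩ := hderiv z hzT
      have hz' : l (v ((extChartAt I₁ x).symm z)) ≠ 0 := hz.ne'
      have h1 : HasFDerivAt (fun z => l (v ((extChartAt I₁ x).symm z))) _ z :=
        l.hasFDerivAt.comp z hα
      refine ((((hasDerivAt_inv hz').comp_hasFDerivAt z h1)).smul hα).congr_fderiv ?_
      ext1 X
      simp only [add_apply, smul_apply, ContinuousLinearMap.smulRight_apply,
        ContinuousLinearMap.comp_apply, map_smul, Function.comp_apply, smul_smul, ← add_smul,
        smul_eq_mul, zero_apply]
      convert zero_smul ℝ _ using 2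
      field_simp
      ring)
  have hne' : ∀ᶠ x' in nhds x, l (v x') ≠ 0 := by
    have := (continuousAt_extChartAt (I := I₁) x).eventually hne
    filter_upwards [this, extChartAt_source_mem_nhds (I := I₁) x] with x' hx' hs'
    rw [Function.comp_apply, (extChartAt I₁ x).left_inv hs'] at hx'
    exact hx'.ne'
  filter_upwards [hconst, hne'] with x' h1 h2
  rw [← Submodule.span_singleton_smul_eq (inv_ne_zero h2).isUnit (v x'), h1,
    Submodule.span_singleton_smul_eq (inv_ne_zero hpos.ne').isUnit]

theorem span_nullVector_eq [PreconnectedSpace N₁]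
    (hdim : Module.finrank ℝ E₁ + 2 * Module.finrank ℝ E₂ = 2 * m)
    (y : N₂) (e : E₂) {s : ℝ} (hs : s * s = 1) (x x' : N₁) :
    Submodule.span ℝ {nullVector I₁ I₂ Φ y e s x} =
      Submodule.span ℝ {nullVector I₁ I₂ Φ y e s x'} :=
  ((IsLocallyConstant.iff_eventually_eq _).2 fun x =>
    hΦ.eventually_span_nullVector hg₂ hdim y e hs x).apply_eq_of_preconnectedSpace x x'

/-- The tangent spaces of the first factor are orthogonal to the null vectors at a fixed point. -/
theorem paraMetric_nullVector_immersionDeriv [PreconnectedSpace N₁]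
    (hdim : Module.finrank ℝ E₁ + 2 * Module.finrank ℝ E₂ = 2 * m)
    (y : N₂) (e : E₂) {s : ℝ} (hs : s * s = 1) (x x' : N₁) (X : E₁) :
    paraMetric m (nullVector I₁ I₂ Φ y e s x)
      (immersionDeriv I₁ (fun x => Φ (x, y)) x' X) = 0 := by
  have J := hΦ.isPRJet hg₂ (x', y)
  have h1 : nullVector I₁ I₂ Φ y e s x ∈ Submodule.span ℝ {nullVector I₁ I₂ Φ y e s x'} := by
    rw [← hΦ.span_nullVector_eq hg₂ hdim y e hs x x']
    exact Submodule.mem_span_singleton_self _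
  obtain ⟨c, hc⟩ := Submodule.mem_span_singleton.1 h1
  rw [← hc, nullVector, hΦ.immersionDeriv_fst hg₂ (x', y), map_smul, map_add, map_smul,
    LinearMap.smul_apply, LinearMap.add_apply, LinearMap.smul_apply, J.antiinvariant,
    J.metric_snd]
  simp

theorem paraMetric_fibre_immersionDeriv [PreconnectedSpace N₁]
    (hdim : Module.finrank ℝ E₁ + 2 * Module.finrank ℝ E₂ = 2 * m)
    (y : N₂) (e : E₂) (x x' : N₁) (X : E₁) :
    paraMetric m (immersionDeriv (I₁.prod I₂) Φ (x, y) (0, e))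
        (immersionDeriv I₁ (fun x => Φ (x, y)) x' X) = 0 ∧
      paraMetric m (paraStructure m (immersionDeriv (I₁.prod I₂) Φ (x, y) (0, e)))
        (immersionDeriv I₁ (fun x => Φ (x, y)) x' X) = 0 := by
  have h1 := hΦ.paraMetric_nullVector_immersionDeriv hg₂ hdim y e (one_mul (1 : ℝ)) x x' X
  have h2 := hΦ.paraMetric_nullVector_immersionDeriv hg₂ hdim y e
    (show (-1 : ℝ) * -1 = 1 by norm_num) x x' X
  simp only [nullVector, map_add, map_smul, LinearMap.add_apply, LinearMap.smul_apply, smul_eq_mul]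
    at h1 h2
  constructor <;> linarith

omit hΦ hg₂ [FiniteDimensional ℝ E₁] in
/-- A linear functional that vanishes on all tangent spaces of a connected manifold is constant. -/
theorem linear_apply_eq_of_deriv [PreconnectedSpace N₁] {φ : N₁ → ParaPlane m}
    (hφ : ContMDiff I₁ 𝓘(ℝ, ParaPlane m) ∞ φ) (l : ParaPlane m →ₗ[ℝ] ℝ)
    (hl : ∀ x X, l (immersionDeriv I₁ φ x X) = 0) (x x' : N₁) : l (φ x) = l (φ x') := by
  refine ((IsLocallyConstant.iff_eventually_eq fun x => l (φ x)).2 fun x =>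
    eventually_eq_of_hasFDerivAt_zero (I := I₁) ?_).apply_eq_of_preconnectedSpace x x'
  filter_upwards [(isOpen_extChartAt_target (I := I₁) x).mem_nhds (mem_extChartAt_target x)]
    with z hz
  have h1 : HasFDerivAt (φ ∘ (extChartAt I₁ x).symm)
      ((modelDeriv I₁ 𝓘(ℝ, ParaPlane m) φ ((extChartAt I₁ x).symm z)).comp
        (modelDeriv 𝓘(ℝ, E₁) I₁ (extChartAt I₁ x).symm z)) z :=
    hasMFDerivAt_iff_hasFDerivAt.1 (HasMFDerivAt.comp z
      (hφ.mdifferentiable (by simp) ((extChartAt I₁ x).symm z)).hasMFDerivAt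
      (mdifferentiableAt_extChartAt_symm_of_boundaryless hz).hasMFDerivAt)
  refine ((LinearMap.toContinuousLinearMap l).hasFDerivAt.comp z h1).congr_fderiv ?_
  ext1 X
  exact hl _ _

omit hΦ hg₂ in
/-- The leaves of the invariant distribution are congruent to open parts of the para-Kähler plane. -/
theorem isCongruentToOpenPart {h p : ℕ} {Φ : N₁ × N₂ → ParaPlane (h + p)}
    (hΦ : IsPRWarpedProduct g₁ g₂ f Φ) (hg₂ : g₂.IsSpacelike) [ConnectedSpace N₁]
    (hh : Module.finrank ℝ E₁ = 2 * h) (hp : Module.finrank ℝ E₂ = p) (y : N₂) :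
    IsCongruentToOpenPart I₁ h p fun x => Φ (x, y) := by
  have hdim : Module.finrank ℝ E₁ + 2 * Module.finrank ℝ E₂ = 2 * (h + p) := by
    rw [hh, hp]; ring
  obtain ⟨x₀⟩ := ‹ConnectedSpace N₁›.toNonempty
  obtain ⟨A, hiso, hstr, hA⟩ := exists_isometry_to_paraInclusion hp
    (immersionDeriv (I₁.prod I₂) Φ (x₀, y) ∘ₗ LinearMap.inr ℝ E₁ E₂) (fun w hw => by
      have J := hΦ.isPRJet hg₂ (x₀, y)
      simp only [LinearMap.comp_apply, LinearMap.inr_apply, J.metric_snd]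
      exact (J.pos w hw).ne')
  have horth := fun x => hΦ.paraMetric_fibre_immersionDeriv hg₂ hdim y (x := x₀) (x' := x)
  have hφ := hΦ.contMDiff_fst y
  have hmem : ∀ x, A (Φ (x, y) - Φ (x₀, y)) =
      paraInclusion h p (paraProjection h p (A (Φ (x, y) - Φ (x₀, y)))) := by
    intro x
    refine hA _ (fun w => ?_) fun w => ?_
    · rw [map_sub, sub_eq_zero]
      exact linear_apply_eq_of_deriv hφ _ (fun x X => (horth x w X).1) x x₀
    · rw [map_sub, sub_eq_zero]
      exact linear_apply_eq_of_deriv hφ _ (fun x X => (horth x w X).2) x x₀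
  have hzero : paraInclusion h p 0 = 0 := by
    ext i <;> refine Fin.addCases (fun j => ?_) (fun j => ?_) i <;> simp [paraInclusion]
  let R : ParaPlane (h + p) →L[ℝ] ParaPlane h :=
    LinearMap.toContinuousLinearMap (paraProjection h p ∘ₗ A.toLinearMap)
  have hR : ∀ v, R v = paraProjection h p (A v) := fun _ => rfl
  refine ⟨A, -A (Φ (x₀, y)), hiso, hstr, fun x => R (Φ (x, y) - Φ (x₀, y)), ?_, fun x => ?_⟩
  · have hψ : ContMDiff I₁ 𝓘(ℝ, ParaPlane h) ∞ fun x => R (Φ (x, y) - Φ (x₀, y)) :=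
      R.contMDiff.comp (hφ.sub contMDiff_const)
    refine isLocalDiffeomorph_of_injective hψ (fun x => ?_) (by rw [hh, finrank_paraPlane])
    have hderiv : ∀ X, modelDeriv I₁ 𝓘(ℝ, ParaPlane h) (fun x => R (Φ (x, y) - Φ (x₀, y))) x X =
        R (immersionDeriv I₁ (fun x => Φ (x, y)) x X) := by
      intro X
      have haff : HasFDerivAt (fun v => R (v - Φ (x₀, y))) R (Φ (x, y)) := by
        exact (R.hasFDerivAt.comp (Φ (x, y))
          ((hasFDerivAt_id (Φ (x, y))).sub_const (Φ (x₀, y)))).congr_fderiv (R.comp_id)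
      have h1 := HasMFDerivAt.comp x haff.hasMFDerivAt
        (hφ.mdifferentiable (by simp) x).hasMFDerivAt
      exact DFunLike.congr_fun
        (f := modelDeriv I₁ 𝓘(ℝ, ParaPlane h) (fun x => R (Φ (x, y) - Φ (x₀, y))) x)
        (g := R.comp (modelDeriv I₁ 𝓘(ℝ, ParaPlane (h + p)) (fun x => Φ (x, y)) x)) h1.mfderiv X
    rw [injective_iff_map_eq_zero]
    intro X hX
    rw [hderiv] at hX
    have h2 := hA (immersionDeriv I₁ (fun x => Φ (x, y)) x X) (fun w => (horth x w X).1)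
      fun w => (horth x w X).2
    rw [← hR, hX, hzero, LinearEquiv.map_eq_zero_iff] at h2
    refine (hΦ.isPRJet hg₂ (x, y)).nondegenerate X fun Y => ?_
    rw [← (hΦ.isPRJet hg₂ (x, y)).metric_fst X (Y, 0), ← hΦ.immersionDeriv_fst hg₂ (x, y), h2,
      map_zero, LinearMap.zero_apply]
  · rw [← sub_eq_add_neg, ← map_sub]
    exact hmem x

end IsPRWarpedProduct

end Congruence

theorem proposition6p1 (h p : ℕ)
    {NT : Type*} [TopologicalSpace NT] [ChartedSpace (EuclideanSpace ℝ (Fin (2 * h))) NT]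
    [IsManifold (𝓡 (2 * h)) ∞ NT] [ConnectedSpace NT]
    {NP : Type*} [TopologicalSpace NP] [ChartedSpace (EuclideanSpace ℝ (Fin p)) NP]
    [IsManifold (𝓡 p) ∞ NP]
    (gT : PseudoRiemannianMetric (𝓡 (2 * h)) NT) (gP : PseudoRiemannianMetric (𝓡 p) NP)
    (f : NT → ℝ) (Φ : NT × NP → ParaPlane (h + p))
    (hΦ : IsPRWarpedProduct gT gP f Φ) (hspace : gP.IsSpacelike)
    (heq : ∀ q : NT × NP,
      normSqSecondFundamentalForm ((𝓡 (2 * h)).prod (𝓡 p)) Φ q =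
        2 * p * normSqGradient ((𝓡 (2 * h)).prod (𝓡 p)) Φ q (fun r => Real.log (f r.1))) :
    (∀ y : NP, IsTotallyGeodesic (𝓡 (2 * h)) (fun x => Φ (x, y)) ∧
      IsCongruentToOpenPart (𝓡 (2 * h)) h p (fun x => Φ (x, y))) ∧
    (∀ x : NT, IsTotallyUmbilical (𝓡 p) (fun y => Φ (x, y))) ∧
    (∀ k : ℝ, 2 ≤ p → HasConstantCurvature gP k →
      ∀ q : NT × NP,
        normSqGradient ((𝓡 (2 * h)).prod (𝓡 p)) Φ q (fun r => f r.1) = k) := by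
  have hh : Module.finrank ℝ (EuclideanSpace ℝ (Fin (2 * h))) = 2 * h := by simp
  have hp : Module.finrank ℝ (EuclideanSpace ℝ (Fin p)) = p := by simp
  have hdim : Module.finrank ℝ (EuclideanSpace ℝ (Fin (2 * h)))
      + 2 * Module.finrank ℝ (EuclideanSpace ℝ (Fin p)) = 2 * (h + p) := by
    rw [hh, hp]; ring
  have heq' : ∀ q : NT × NP, normSqSecondFundamentalForm ((𝓡 (2 * h)).prod (𝓡 p)) Φ q =
      2 * Module.finrank ℝ (EuclideanSpace ℝ (Fin p)) *
        normSqGradient ((𝓡 (2 * h)).prod (𝓡 p)) Φ q fun r => Real.log (f r.1) := by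
    intro q
    rw [hp]
    exact heq q
  refine ⟨fun y => ⟨hΦ.isTotallyGeodesic_fst hspace hdim y,
    hΦ.isCongruentToOpenPart hspace hh hp y⟩, fun x =>
    ⟨hΦ.isPseudoRiemannianImmersion_snd hspace x, fun y ξ _ =>
      hΦ.exists_shapeOperator_eq hspace hdim (heq' (x, y)) ξ⟩, fun k hp2 hk q =>
    hΦ.normSqGradient_eq_of_constantCurvature hspace hdim (heq' q) hp2 hk⟩
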